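/- Let $k$ be a field and let $S=\bigoplus_{i\in\mathbb Z}S_i$ be a $\mathbb Z$-graded commutative noetherian domain which is a finitely generated graded $k$-algebra, with $S_i=0$ for all sufficiently small $i$ and with Krull dimension $2$. Let $\operatorname{gr}(S)$ be the category of finitely generated $\mathbb Z$-graded $S$-modules with degree-zero homomorphisms, and let $\operatorname{qgr}(S)$ be the (Serre--Gabriel) quotient category of $\operatorname{gr}(S)$ by the Serre subcategory of modules of finite length (equivalently, of Krull dimension at most $0$). Then the abelian category $\operatorname{qgr}(S)$ is hereditary, i.e. $\operatorname{Ext}^i_{\operatorname{qgr}(S)}(X,Y)=0$ for all objects $X,Y$ and all $i\ge 2$, if and only if $S$ is an isolated singularity, i.e. the local ring $S_P$ is regular for every non-maximal prime ideal $P$ of $S$ (so regular rings are included). -/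

import Mathlib

open CategoryTheory CategoryTheory.Limits

universe u v

/-- A finitely generated `ℤ`-graded module over the `ℤ`-graded `k`-algebra `S = ⨁ i, 𝒜 i`:
an `S`-module which is the internal direct sum of additive subgroups `piece i`, `i ∈ ℤ`, with
`𝒜 i • piece j ⊆ piece (i + j)`. -/
structure GrMod {k : Type v} {S : Type u} [Field k] [CommRing S] [Algebra k S]
    (𝒜 : ℤ → Submodule k S) : Type (u + 1) where
  carrier : Type u
  [addCommGroup : AddCommGroup carrier]
  [module : Module S carrier]
  [finite : Module.Finite S carrier]
  piece : ℤ → AddSubgroup carrier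
  isInternal : DirectSum.IsInternal piece
  smul_mem : ∀ {i j : ℤ} {a : S} {x : carrier}, a ∈ 𝒜 i → x ∈ piece j → a • x ∈ piece (i + j)

namespace GrMod

attribute [instance] GrMod.addCommGroup GrMod.module GrMod.finite

/-- To show that a family of subgroups is an internal grading it is enough to exhibit
the projections on the homogeneous components. -/
theorem isInternal_of_proj {M : Type*} [AddCommGroup M] (P : ℤ → AddSubgroup M)
    (p : ℤ → M →+ M) (h₁ : ∀ i x, p i x ∈ P i) (h₂ : ∀ i, ∀ x ∈ P i, p i x = x)
    (h₃ : ∀ i j, i ≠ j → ∀ x ∈ P j, p i x = 0)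
    (h₄ : ∀ x, ∃ s : Finset ℤ, ∑ i ∈ s, p i x = x) : DirectSum.IsInternal P := by
  classical
  constructor
  · have key : ∀ (a : DirectSum ℤ fun i => P i) (i : ℤ),
        p i (DirectSum.coeAddMonoidHom P a) = a i := by
      intro a i
      induction a using DirectSum.induction_on with
      | zero => simp
      | of j x =>
        rw [DirectSum.coeAddMonoidHom_of]
        by_cases hij : i = j
        · subst hij
          rw [DirectSum.of_eq_same, h₂ i _ x.2]
        · rw [DirectSum.of_eq_of_ne _ _ _ hij, h₃ i j hij _ x.2]; rfl
      | add a b iha ihb =>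
        rw [map_add, map_add, DirectSum.add_apply, AddSubgroup.coe_add, iha, ihb]
    rw [injective_iff_map_eq_zero]
    intro a ha
    ext i
    rw [← key a i, ha, map_zero]; rfl
  · intro x
    obtain ⟨s, hs⟩ := h₄ x
    refine ⟨∑ i ∈ s, DirectSum.of (fun i => P i) i ⟨p i x, h₁ i x⟩, ?_⟩
    rw [map_sum]
    simpa using hs

variable {k : Type v} {S : Type u} [Field k] [CommRing S] [Algebra k S] {𝒜 : ℤ → Submodule k S}

/-- The projection of a graded module on its component of degree `i`. -/
noncomputable def proj (X : GrMod 𝒜) (i : ℤ) : X.carrier →+ X.carrier :=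
  ((X.piece i).subtype.comp (DFinsupp.evalAddMonoidHom i)).comp
    (AddEquiv.ofBijective _ X.isInternal).symm.toAddMonoidHom

theorem proj_mem (X : GrMod 𝒜) (i : ℤ) (x : X.carrier) : X.proj i x ∈ X.piece i :=
  SetLike.coe_mem _

theorem symm_of (X : GrMod 𝒜) (j : ℤ) (x : X.piece j) :
    (AddEquiv.ofBijective _ X.isInternal).symm (x : X.carrier) =
      DirectSum.of (fun i => X.piece i) j x := by
  rw [AddEquiv.symm_apply_eq]
  exact (DirectSum.coeAddMonoidHom_of X.piece j x).symm

theorem proj_of_mem (X : GrMod 𝒜) (i : ℤ) (x : X.carrier) (hx : x ∈ X.piece i) :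
    X.proj i x = x := by
  have h := X.symm_of i ⟨x, hx⟩
  change (((AddEquiv.ofBijective _ X.isInternal).symm x) i : X.carrier) = x
  rw [h, DirectSum.of_eq_same]

theorem proj_of_ne (X : GrMod 𝒜) (i j : ℤ) (hij : i ≠ j) (x : X.carrier) (hx : x ∈ X.piece j) :
    X.proj i x = 0 := by
  have h := X.symm_of j ⟨x, hx⟩
  change (((AddEquiv.ofBijective _ X.isInternal).symm x) i : X.carrier) = 0
  rw [h, DirectSum.of_eq_of_ne _ _ _ hij]; rfl

theorem sum_proj (X : GrMod 𝒜) (x : X.carrier) :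
    ∃ s : Finset ℤ, ∀ t, s ⊆ t → ∑ i ∈ t, X.proj i x = x := by
  classical
  obtain ⟨a, rfl⟩ := X.isInternal.2 x
  refine ⟨DFinsupp.support a, fun t ht => ?_⟩
  have h : ∀ i, X.proj i (DirectSum.coeAddMonoidHom X.piece a) = a i := fun i => by
    change (((AddEquiv.ofBijective _ X.isInternal).symm
      ((AddEquiv.ofBijective _ X.isInternal) a)) i : X.carrier) = a i
    rw [AddEquiv.symm_apply_apply]
  simp_rw [h]
  rw [DirectSum.coeAddMonoidHom_eq_dfinsuppSum, DFinsupp.sum]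
  refine (Finset.sum_subset ht fun i _ hi => ?_).symm
  rw [DFinsupp.notMem_support_iff.mp hi]; rfl

/-- A morphism of graded modules: an `S`-linear map that preserves degrees. -/
@[ext]
structure Hom (X Y : GrMod 𝒜) : Type u where
  lin : X.carrier →ₗ[S] Y.carrier
  map_mem : ∀ {i : ℤ} {x : X.carrier}, x ∈ X.piece i → lin x ∈ Y.piece i

/-- The category `gr S` of finitely generated graded modules with degree zero morphisms. -/
instance : Category (GrMod 𝒜) where
  Hom := Hom
  id X := ⟨LinearMap.id, fun h => h⟩
  comp f g := ⟨g.lin.comp f.lin, fun h => g.map_mem (f.map_mem h)⟩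

@[ext]
theorem hom_ext {X Y : GrMod 𝒜} {f g : X ⟶ Y} (h : ∀ x, f.lin x = g.lin x) : f = g :=
  Hom.ext (LinearMap.ext h)

@[simp] theorem id_lin (X : GrMod 𝒜) : (𝟙 X : X ⟶ X).lin = LinearMap.id := rfl
@[simp] theorem comp_lin {X Y Z : GrMod 𝒜} (f : X ⟶ Y) (g : Y ⟶ Z) :
    (f ≫ g).lin = g.lin.comp f.lin := rfl

theorem map_proj {X Y : GrMod 𝒜} (f : X ⟶ Y) (i : ℤ) (x : X.carrier) :
    f.lin (X.proj i x) = Y.proj i (f.lin x) := by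
  classical
  obtain ⟨a, rfl⟩ := X.isInternal.2 x
  induction a using DirectSum.induction_on with
  | zero => simp
  | of j x =>
    rw [DirectSum.coeAddMonoidHom_of]
    by_cases hij : i = j
    · subst hij
      rw [X.proj_of_mem i _ x.2, Y.proj_of_mem i _ (f.map_mem x.2)]
    · rw [X.proj_of_ne i j hij _ x.2, Y.proj_of_ne i j hij _ (f.map_mem x.2), map_zero]
  | add a b iha ihb => simp only [map_add, iha, ihb]

instance (X Y : GrMod 𝒜) : Zero (X ⟶ Y) := ⟨⟨0, fun _ => zero_mem _⟩⟩
instance (X Y : GrMod 𝒜) : Add (X ⟶ Y) :=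
  ⟨fun f g => ⟨f.lin + g.lin, fun h => add_mem (f.map_mem h) (g.map_mem h)⟩⟩
instance (X Y : GrMod 𝒜) : Neg (X ⟶ Y) := ⟨fun f => ⟨-f.lin, fun h => neg_mem (f.map_mem h)⟩⟩

@[simp] theorem zero_lin (X Y : GrMod 𝒜) : (0 : X ⟶ Y).lin = 0 := rfl
@[simp] theorem add_lin {X Y : GrMod 𝒜} (f g : X ⟶ Y) : (f + g).lin = f.lin + g.lin := rfl
@[simp] theorem neg_lin {X Y : GrMod 𝒜} (f : X ⟶ Y) : (-f).lin = -f.lin := rfl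

instance (X Y : GrMod 𝒜) : AddCommGroup (X ⟶ Y) where
  add_assoc f g h := by ext; simp [add_assoc]
  zero_add f := by ext; simp
  add_zero f := by ext; simp
  neg_add_cancel f := by ext; simp
  add_comm f g := by ext; simp [add_comm]
  nsmul := nsmulRec
  zsmul := zsmulRec

instance : Preadditive (GrMod 𝒜) where
  add_comp _ _ _ f g h := by ext; simp
  comp_add _ _ _ f g h := by ext; simp

/-- The zero graded module. -/
def zeroObj (𝒜 : ℤ → Submodule k S) : GrMod 𝒜 where
  carrier := PUnit
  piece _ := ⊤
  isInternal := isInternal_of_proj _ (fun _ => 0) (fun _ _ => trivial) (fun _ _ _ => rfl)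
    (fun _ _ _ _ _ => rfl) (fun _ => ⟨∅, rfl⟩)
  smul_mem _ _ := trivial

theorem isZero_of_subsingleton (X : GrMod 𝒜) [Subsingleton X.carrier] : IsZero X := by
  rw [IsZero.iff_id_eq_zero]
  ext x
  exact Subsingleton.elim _ _

theorem isZero_zeroObj : IsZero (zeroObj 𝒜) :=
  have : Subsingleton (zeroObj 𝒜).carrier := inferInstanceAs (Subsingleton PUnit)
  isZero_of_subsingleton _

instance : HasZeroObject (GrMod 𝒜) := ⟨⟨_, isZero_zeroObj⟩⟩

/-- The direct sum of two graded modules. -/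
def prod (X Y : GrMod 𝒜) : GrMod 𝒜 where
  carrier := X.carrier × Y.carrier
  piece i := (X.piece i).prod (Y.piece i)
  isInternal := isInternal_of_proj _ (fun i => (X.proj i).prodMap (Y.proj i))
    (fun i x => ⟨X.proj_mem i _, Y.proj_mem i _⟩)
    (fun i x hx => Prod.ext (X.proj_of_mem i _ hx.1) (Y.proj_of_mem i _ hx.2))
    (fun i j hij x hx => Prod.ext (X.proj_of_ne i j hij _ hx.1) (Y.proj_of_ne i j hij _ hx.2))
    (fun x => by
      classical
      obtain ⟨s, hs⟩ := X.sum_proj x.1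
      obtain ⟨t, ht⟩ := Y.sum_proj x.2
      refine ⟨s ∪ t, Prod.ext ?_ ?_⟩
      · rw [Prod.fst_sum]; exact hs _ Finset.subset_union_left
      · rw [Prod.snd_sum]; exact ht _ Finset.subset_union_right)
  smul_mem ha hx := ⟨X.smul_mem ha hx.1, Y.smul_mem ha hx.2⟩


instance : HasBinaryBiproducts (GrMod 𝒜) where
  has_binary_biproduct X Y := HasBinaryBiproduct.mk
    { bicone :=
        { pt := X.prod Y
          fst := ⟨LinearMap.fst S _ _, fun h => h.1⟩
          snd := ⟨LinearMap.snd S _ _, fun h => h.2⟩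
          inl := ⟨LinearMap.inl S _ _, fun h => ⟨h, zero_mem _⟩⟩
          inr := ⟨LinearMap.inr S _ _, fun h => ⟨zero_mem _, h⟩⟩
          inl_fst := rfl
          inl_snd := rfl
          inr_fst := rfl
          inr_snd := rfl }
      isBilimit := isBinaryBilimitOfTotal _ (by
        ext x
        exact Prod.ext (add_zero x.1) (zero_add x.2)) }

instance : HasFiniteProducts (GrMod 𝒜) :=
  have : HasTerminal (GrMod 𝒜) := HasZeroObject.hasTerminal
  hasFiniteProducts_of_has_binary_and_terminal

/-- The quotient of `Y` by the image of a morphism `f : X ⟶ Y`. -/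
def coker {X Y : GrMod 𝒜} (f : X ⟶ Y) : GrMod 𝒜 where
  carrier := Y.carrier ⧸ LinearMap.range f.lin
  piece i := (Y.piece i).map (LinearMap.range f.lin).mkQ.toAddMonoidHom
  isInternal := isInternal_of_proj _
    (fun i => QuotientAddGroup.map _ _ (Y.proj i) (by
      rintro _ ⟨x, rfl⟩
      exact ⟨X.proj i x, map_proj f i x⟩))
    (fun i x => by
      induction x using Submodule.Quotient.induction_on with
      | H x => exact ⟨_, Y.proj_mem i x, rfl⟩)
    (fun i x hx => by
      obtain ⟨y, hy, rfl⟩ := hx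
      exact congrArg (LinearMap.range f.lin).mkQ (Y.proj_of_mem i y hy))
    (fun i j hij x hx => by
      obtain ⟨y, hy, rfl⟩ := hx
      exact (congrArg (LinearMap.range f.lin).mkQ (Y.proj_of_ne i j hij y hy)).trans (map_zero _))
    (fun x => by
      induction x using Submodule.Quotient.induction_on with
      | H x =>
        obtain ⟨s, hs⟩ := Y.sum_proj x
        refine ⟨s, ?_⟩
        have h := congrArg (LinearMap.range f.lin).mkQ (hs s subset_rfl)
        rw [map_sum] at h
        exact h)
  smul_mem := by
    rintro i j a _ ha ⟨x, hx, rfl⟩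
    exact ⟨a • x, Y.smul_mem ha hx, rfl⟩

/-- The projection `Y ⟶ coker f`. -/
def cokerπ {X Y : GrMod 𝒜} (f : X ⟶ Y) : Y ⟶ coker f :=
  ⟨(LinearMap.range f.lin).mkQ, fun h => ⟨_, h, rfl⟩⟩

theorem comp_cokerπ {X Y : GrMod 𝒜} (f : X ⟶ Y) : f ≫ cokerπ f = 0 := by
  ext x
  exact (Submodule.Quotient.mk_eq_zero _).mpr ⟨x, rfl⟩

theorem cokerπ_surjective {X Y : GrMod 𝒜} (f : X ⟶ Y) : Function.Surjective (cokerπ f).lin :=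
  Submodule.mkQ_surjective _

theorem cokerπ_eq_zero_iff {X Y : GrMod 𝒜} (f : X ⟶ Y) (y : Y.carrier) :
    (cokerπ f).lin y = 0 ↔ y ∈ LinearMap.range f.lin :=
  Submodule.Quotient.mk_eq_zero _

/-- A surjective morphism `p : Y ⟶ Z` is a cokernel of any `f` whose image is the kernel of `p`. -/
noncomputable def isColimitOfExact {X Y Z : GrMod 𝒜} (f : X ⟶ Y) (p : Y ⟶ Z) (w : f ≫ p = 0)
    (hp : Function.Surjective p.lin) (hk : ∀ y, p.lin y = 0 → y ∈ LinearMap.range f.lin) :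
    IsColimit (CokernelCofork.ofπ p w) :=
  have le : ∀ {W : GrMod 𝒜} (g : Y ⟶ W) (_ : f ≫ g = 0),
      LinearMap.ker p.lin ≤ LinearMap.ker g.lin := by
    intro W g hg y hy
    obtain ⟨x, rfl⟩ := hk y hy
    exact congrArg (fun h : X ⟶ W => h.lin x) hg
  have key : ∀ {W : GrMod 𝒜} (g : Y ⟶ W) (hg : f ≫ g = 0) (y : Y.carrier),
      (LinearMap.ker p.lin).liftQ g.lin (le g hg)
        ((p.lin.quotKerEquivOfSurjective hp).symm (p.lin y)) = g.lin y := by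
    intro W g hg y
    have e : (p.lin.quotKerEquivOfSurjective hp).symm (p.lin y) = Submodule.Quotient.mk y := by
      rw [LinearEquiv.symm_apply_eq]; rfl
    rw [e]; rfl
  CokernelCofork.IsColimit.ofπ p w
    (fun {W} g hg =>
      { lin := ((LinearMap.ker p.lin).liftQ g.lin (le g hg)).comp
          (p.lin.quotKerEquivOfSurjective hp).symm.toLinearMap
        map_mem := by
          intro i z hz
          obtain ⟨y, rfl⟩ := hp z
          have h : p.lin (Y.proj i y) = p.lin y := by
            rw [map_proj, Z.proj_of_mem i _ hz]
          rw [← h]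
          exact (key g hg (Y.proj i y)).symm ▸ g.map_mem (Y.proj_mem i y) })
    (fun {W} g hg => by
      ext y
      exact key g hg y)
    (fun {W} g hg m hm => by
      ext z
      obtain ⟨y, rfl⟩ := hp z
      exact (congrArg (fun h : Y ⟶ W => h.lin y) hm).trans (key g hg y).symm)

instance : HasCokernels (GrMod 𝒜) where
  has_colimit f := ⟨⟨_, isColimitOfExact f (cokerπ f) (comp_cokerπ f) (cokerπ_surjective f)
    fun y hy => (cokerπ_eq_zero_iff f y).mp hy⟩⟩

theorem surjective_of_epi {X Y : GrMod 𝒜} (f : X ⟶ Y) [Epi f] : Function.Surjective f.lin := by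
  have h : cokerπ f = 0 := by rw [← cancel_epi f, comp_cokerπ, comp_zero]
  intro y
  exact (cokerπ_eq_zero_iff f y).mp (congrArg (fun g : Y ⟶ coker f => g.lin y) h)

/-- An injective morphism `m : X ⟶ Y` is a kernel of any `f` whose kernel is the image of `m`. -/
noncomputable def isLimitOfExact {X Y Z : GrMod 𝒜} (m : X ⟶ Y) (f : Y ⟶ Z) (w : m ≫ f = 0)
    (hm : Function.Injective m.lin) (hk : ∀ y, f.lin y = 0 → y ∈ LinearMap.range m.lin) :
    IsLimit (KernelFork.ofι m w) :=
  have key : ∀ {W : GrMod 𝒜} (g : W ⟶ Y) (_ : g ≫ f = 0) (x : W.carrier),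
      g.lin x ∈ LinearMap.range m.lin := fun {W} g hg x =>
    hk _ (congrArg (fun h : W ⟶ Z => h.lin x) hg)
  have key' : ∀ {W : GrMod 𝒜} (g : W ⟶ Y) (hg : g ≫ f = 0) (x : W.carrier),
      m.lin ((LinearEquiv.ofInjective m.lin hm).symm ⟨g.lin x, key g hg x⟩) = g.lin x :=
    fun {W} g hg x => by
      have h := (LinearEquiv.ofInjective m.lin hm).apply_symm_apply ⟨g.lin x, key g hg x⟩
      exact congrArg Subtype.val h
  KernelFork.IsLimit.ofι m w
    (fun {W} g hg =>
      { lin := (LinearEquiv.ofInjective m.lin hm).symm.toLinearMap.comp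
          (g.lin.codRestrict (LinearMap.range m.lin) (key g hg))
        map_mem := by
          intro i x hx
          change (LinearEquiv.ofInjective m.lin hm).symm ⟨g.lin x, key g hg x⟩ ∈ X.piece i
          have h : X.proj i ((LinearEquiv.ofInjective m.lin hm).symm ⟨g.lin x, key g hg x⟩) =
              (LinearEquiv.ofInjective m.lin hm).symm ⟨g.lin x, key g hg x⟩ := by
            apply hm
            rw [map_proj, key' g hg x, Y.proj_of_mem i _ (g.map_mem hx)]
          rw [← h]
          exact X.proj_mem i _ })
    (fun {W} g hg => by
      ext x
      exact key' g hg x)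
    (fun {W} g hg l hl => by
      ext x
      apply hm
      exact (congrArg (fun h : W ⟶ Y => h.lin x) hl).trans (key' g hg x).symm)

section Noetherian

variable [IsNoetherianRing S]

/-- The kernel of a morphism of finitely generated graded modules. -/
def ker {X Y : GrMod 𝒜} (f : X ⟶ Y) : GrMod 𝒜 where
  carrier := LinearMap.ker f.lin
  piece i := (X.piece i).comap (LinearMap.ker f.lin).subtype.toAddMonoidHom
  isInternal := isInternal_of_proj _
    (fun i => ((X.proj i).comp (LinearMap.ker f.lin).subtype.toAddMonoidHom).codRestrict
      (LinearMap.ker f.lin) fun x => by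
        change f.lin (X.proj i x) = 0
        rw [map_proj, LinearMap.mem_ker.mp x.2, map_zero])
    (fun i x => X.proj_mem i x)
    (fun i x hx => Subtype.ext (X.proj_of_mem i _ hx))
    (fun i j hij x hx => Subtype.ext (X.proj_of_ne i j hij _ hx))
    (fun x => by
      obtain ⟨s, hs⟩ := X.sum_proj x.1
      refine ⟨s, Subtype.ext ?_⟩
      rw [AddSubmonoidClass.coe_finsetSum]
      exact hs s subset_rfl)
  smul_mem ha hx := X.smul_mem ha hx

/-- The inclusion `ker f ⟶ X`. -/
def kerι {X Y : GrMod 𝒜} (f : X ⟶ Y) : ker f ⟶ X :=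
  ⟨(LinearMap.ker f.lin).subtype, fun h => h⟩

theorem kerι_comp {X Y : GrMod 𝒜} (f : X ⟶ Y) : kerι f ≫ f = 0 := by
  ext x
  exact x.2

theorem kerι_injective {X Y : GrMod 𝒜} (f : X ⟶ Y) : Function.Injective (kerι f).lin :=
  Subtype.val_injective

theorem mem_range_kerι {X Y : GrMod 𝒜} (f : X ⟶ Y) (x : X.carrier) (hx : f.lin x = 0) :
    x ∈ LinearMap.range (kerι f).lin :=
  ⟨⟨x, hx⟩, rfl⟩

instance : HasKernels (GrMod 𝒜) where
  has_limit f := ⟨⟨_, isLimitOfExact (kerι f) f (kerι_comp f) (kerι_injective f)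
    (mem_range_kerι f)⟩⟩

theorem injective_of_mono {X Y : GrMod 𝒜} (f : X ⟶ Y) [Mono f] : Function.Injective f.lin := by
  have h : kerι f = 0 := by rw [← cancel_mono f, kerι_comp, zero_comp]
  rw [injective_iff_map_eq_zero]
  intro x hx
  exact congrArg (fun g : ker f ⟶ X => g.lin ⟨x, hx⟩) h

noncomputable instance : Abelian (GrMod 𝒜) where
  normalMonoOfMono f _ := ⟨
    { Z := coker f
      g := cokerπ f
      w := comp_cokerπ f
      isLimit := isLimitOfExact f (cokerπ f) (comp_cokerπ f) (injective_of_mono f)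
        fun y hy => (cokerπ_eq_zero_iff f y).mp hy }⟩
  normalEpiOfEpi f _ := ⟨
    { W := ker f
      g := kerι f
      w := kerι_comp f
      isColimit := isColimitOfExact (kerι f) f (kerι_comp f) (surjective_of_epi f)
        (mem_range_kerι f) }⟩

/-- The property that a graded module has finite length as an `S`-module. -/
def finiteLength (𝒜 : ℤ → Submodule k S) : ObjectProperty (GrMod 𝒜) :=
  fun X => IsFiniteLength S X.carrier

theorem finiteLength_iff (X : GrMod 𝒜) : finiteLength 𝒜 X ↔ IsArtinian S X.carrier :=
  (isFiniteLength_iff_isNoetherian_isArtinian).trans ⟨fun h => h.2, fun h => ⟨inferInstance, h⟩⟩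

instance : (finiteLength 𝒜).IsSerreClass where
  exists_zero := ⟨_, isZero_zeroObj, by
    have : Subsingleton (zeroObj 𝒜).carrier := inferInstanceAs (Subsingleton PUnit)
    exact .of_subsingleton⟩
  prop_of_mono f _ h := by
    rw [finiteLength_iff] at h ⊢
    exact isArtinian_of_injective f.lin (injective_of_mono f)
  prop_of_epi f _ h := by
    rw [finiteLength_iff] at h ⊢
    exact isArtinian_of_surjective _ f.lin (surjective_of_epi f)
  prop_X₂_of_shortExact {T} hT h₁ h₃ := by
    rw [finiteLength_iff] at h₁ h₃ ⊢
    have := hT.mono_f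
    have := hT.epi_g
    refine isArtinian_of_range_eq_ker T.f.lin T.g.lin ?_
    apply le_antisymm
    · rintro _ ⟨x, rfl⟩
      exact congrArg (fun g : T.X₁ ⟶ T.X₃ => g.lin x) T.zero
    · intro y hy
      have h := hT.exact.fIsKernel
      obtain ⟨l, hl⟩ := KernelFork.IsLimit.lift' h (kerι T.g) (kerι_comp T.g)
      refine ⟨l.lin ⟨y, hy⟩, ?_⟩
      exact congrArg (fun g : ker T.g ⟶ T.X₂ => g.lin ⟨y, hy⟩) hl

end Noetherian

end GrMod

/-- The quotient category `qgr S = gr S / (finite length)` in the sense of Serre and Gabriel. -/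
abbrev QGr {k : Type v} {S : Type u} [Field k] [CommRing S] [Algebra k S] [IsNoetherianRing S]
    (𝒜 : ℤ → Submodule k S) : Type (u + 1) :=
  (GrMod.finiteLength 𝒜).isoModSerre.Localization

noncomputable instance QGr.abelian {k : Type v} {S : Type u} [Field k] [CommRing S] [Algebra k S]
    [IsNoetherianRing S] (𝒜 : ℤ → Submodule k S) : Abelian (QGr 𝒜) :=
  ObjectProperty.SerreClassLocalization.abelian
    (GrMod.finiteLength 𝒜).isoModSerre.Q (GrMod.finiteLength 𝒜)

/-- An abelian category is hereditary if `Ext^i(X, Y) = 0` for all objects `X`, `Y` and all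
`i ≥ 2`. -/
def IsHereditary (C : Type*) [Category C] [Abelian C] : Prop :=
  letI := HasExt.standard C
  ∀ (X Y : C) (i : ℕ), 2 ≤ i → Subsingleton (Abelian.Ext X Y i)

/-- A noetherian ring is an isolated singularity if its localizations at all non-maximal
prime ideals are regular local rings. (The regular case is included.) -/
def IsIsolatedSingularity (S : Type*) [CommRing S] : Prop :=
  IsNoetherianRing S ∧ ∀ (P : Ideal S) [P.IsPrime], ¬ P.IsMaximal →
    IsRegularLocalRing (Localization.AtPrime P)

-- Write O(m) for the image in qgr of the shifted free module S(m). The engine is an annihilation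
-- principle (`exists_comp_mul_eq_zero`). A class of positive degree on O(m) dies on some
-- epimorphism in qgr, hence on a graded map E → S(m) whose cokernel has finite length. The image of
-- E is a homogeneous ideal not contained in a given non-maximal prime P, so it contains a
-- homogeneous a ∉ P. Multiplication by a on S(m) factors through a shift of E, hence a kills the
-- class.
--
-- Isolated singularity implies hereditary. Modulo a nonzero non-maximal prime P, any homogeneous a
-- ∉ P is invertible in qgr, because S/(P + a) is artinian in dimension 2. Dévissage then gives
-- Ext^i(O(m), torsion) = 0 for i ≥ 1, and dividing by some a ≠ 0 gives Ext^i(O(m), -) = 0 for i ≥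
-- 2. It follows that a homogeneous f ≠ 0 acts surjectively on Ext¹(O(m), -), so Ext²(S/f, -) = 0.
-- If P is a homogeneous prime with S_P a discrete valuation ring, there is a homogeneous
-- uniformizer f and a homogeneous s ∉ P with sP ⊆ (f). Multiplication by s on S/P then factors
-- through S/f and is invertible in qgr, so Ext²(S/P, -) = 0. Dévissage in the first variable gives
-- Ext² = 0, and effaceability gives the vanishing in all higher degrees.
--
-- Hereditary implies isolated singularity. If P contains no nonzero homogeneous element, division
-- with remainder shows that P S_P is principal, whatever the Ext groups are. Otherwise the
-- homogeneous core of a non-maximal P is a nonzero prime and equals P by dimension. Let 0 → K → F →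
-- P → 0 be exact with F graded free. Since Ext²(S/P, K) = 0, the class of this extension extends to
-- O, so a homogeneous a ∉ P kills it. Up to factors outside P the sequence therefore splits: there
-- are linear ψ_i : P → S and generators f_i with Σ ψ_i(x) f_i = b x and b ∉ P. By Nakayama some
-- ψ_i(y) lies outside P, and ψ_i(y) p = ψ_i(p) y shows that y generates P S_P.

universe w

/-! ### Effaceability of Ext in an abelian category. -/

namespace CategoryTheory.Abelian.Ext

universe w' v' u'

variable {C : Type u'} [Category.{v'} C] [Abelian C] [HasExt.{w'} C]

/-- Every extension class of positive degree vanishes after restriction along some epimorphism. -/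
theorem exists_epi_comp_eq_zero {X Y : C} {n : ℕ} (α : Ext X Y (n + 1)) :
    ∃ (A : C) (p : A ⟶ X) (_ : Epi p), (mk₀ p).comp α (zero_add _) = 0 := by
  let := HasDerivedCategory.standard C
  let KX := (CochainComplex.singleFunctor C 0).obj X
  let KY := (CochainComplex.singleFunctor C 0).obj Y
  let e : (DerivedCategory.Q.obj KY)⟦((n + 1 : ℕ) : ℤ)⟧ ≅
      DerivedCategory.Q.obj (KY⟦((n + 1 : ℕ) : ℤ)⟧) :=
    ((DerivedCategory.Q.commShiftIso ((n + 1 : ℕ) : ℤ)).app KY).symm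
  obtain ⟨K, hK, s, hs, g, hg⟩ := DerivedCategory.right_fac_of_isStrictlyLE (X := KX)
    (Y := KY⟦((n + 1 : ℕ) : ℤ)⟧) (α.hom ≫ e.hom) 0
  have hK1 : IsZero (K.X 1) := K.isZero_of_isStrictlyLE 0 1
  -- `K` lives in degrees ≤ 0, so its top term `K.X 0`, placed in degree 0, maps to `K`; composing
  -- with the quasi-isomorphism `s` gives the required epimorphism `p`.
  let i : (CochainComplex.singleFunctor C 0).obj (K.X 0) ⟶ K :=
    HomologicalComplex.mkHomFromSingle (𝟙 _) (fun j hj => by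
      obtain rfl : j = 1 := by simpa using hj.symm
      exact hK1.eq_of_tgt _ _)
  obtain ⟨p, hp⟩ := (CochainComplex.singleFunctor C 0).map_surjective (i ≫ s)
  -- The source sits in degree 0 and the target in degree `-(n + 1) < 0`. This is where positivity
  -- of the degree enters.
  have hig : i ≫ g = 0 := by
    have : (KY⟦((n + 1 : ℕ) : ℤ)⟧).IsStrictlyLE (-((n + 1 : ℕ) : ℤ)) :=
      CochainComplex.isStrictlyLE_shift _ 0 _ _ (by lia)
    ext j
    by_cases hj : j < 0
    · exact ((CochainComplex.isZero_of_isStrictlyGE _ 0 j hj :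
        IsZero (((CochainComplex.singleFunctor C 0).obj (K.X 0)).X j))).eq_of_src _ _
    · exact (CochainComplex.isZero_of_isStrictlyLE _ (-((n + 1 : ℕ) : ℤ)) j (by lia)).eq_of_tgt _ _
  refine ⟨K.X 0, p, ?_, ?_⟩
  -- If `p ≫ u = 0` then `s` followed by `u` vanishes as a map of complexes; `s` is invertible in
  -- the derived category, so `u = 0`.
  · rw [Preadditive.epi_iff_cancel_zero]
    intro Z u hu
    have h1 : s ≫ (CochainComplex.singleFunctor C 0).map u = 0 := by
      have h2 : i ≫ s ≫ (CochainComplex.singleFunctor C 0).map u = 0 := by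
        rw [← Category.assoc, ← hp, ← Functor.map_comp, hu, Functor.map_zero]
      ext j
      by_cases hj : j = 0
      · subst hj
        have h3 := congrArg (fun φ => HomologicalComplex.Hom.f φ 0) h2
        have hi : IsIso (i.f 0) := by
          rw [HomologicalComplex.mkHomFromSingle_f, Category.comp_id]
          exact Iso.isIso_hom _
        rw [← cancel_epi (i.f 0)]
        simpa using h3
      · apply IsZero.eq_of_tgt
        exact HomologicalComplex.isZero_single_obj_X _ _ _ _ hj
    have h4 : DerivedCategory.Q.map ((CochainComplex.singleFunctor C 0).map u) = 0 := by
      rw [← cancel_epi (DerivedCategory.Q.map s), ← Functor.map_comp, h1, Functor.map_zero,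
        Limits.comp_zero]
    apply (DerivedCategory.singleFunctor C 0).map_injective
    rw [Functor.map_zero]
    exact h4
  · ext
    rw [comp_hom, mk₀_hom, ShiftedHom.mk₀_comp, zero_hom]
    refine (cancel_mono e.hom).mp ?_
    refine (Category.assoc _ _ _).trans ?_
    refine (congrArg (fun z => DerivedCategory.Q.map
      ((CochainComplex.singleFunctor C 0).map p) ≫ z) hg).trans ?_
    refine Eq.trans ?_ Limits.zero_comp.symm
    rw [hp, Functor.map_comp, Category.assoc, IsIso.hom_inv_id_assoc, ← Functor.map_comp, hig,
      Functor.map_zero]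

/-- Every extension class of positive degree is a composition with the class of a
short exact sequence. -/
theorem exists_extClass_comp {X Y : C} {n : ℕ} (α : Ext X Y (n + 1)) :
    ∃ (A : C) (p : A ⟶ X) (_ : Epi p) (hS : (ShortComplex.mk _ _ (kernel.condition p)).ShortExact)
      (β : Ext (kernel p) Y n), hS.extClass.comp β (by lia) = α := by
  obtain ⟨A, p, hp, h⟩ := exists_epi_comp_eq_zero α
  have hS : (ShortComplex.mk _ _ (kernel.condition p)).ShortExact :=
    { exact := ShortComplex.exact_kernel p }
  obtain ⟨β, hβ⟩ := contravariant_sequence_exact₃ hS Y α h (n₀ := n) (by lia)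
  exact ⟨A, p, hp, hS, β, hβ⟩

/-- Dimension shifting: a class of degree `n + 1` is a Yoneda product with a factor of degree `n`.
-/
theorem eq_zero_of_two_le (h : ∀ (X Y : C) (α : Ext X Y 2), α = 0) {X Y : C} {n : ℕ} (hn : 2 ≤ n)
    (α : Ext X Y n) : α = 0 := by
  induction n, hn using Nat.le_induction generalizing X Y with
  | base => exact h X Y α
  | succ n hn ih =>
    obtain ⟨A, p, _, hS, β, rfl⟩ := exists_extClass_comp α
    rw [ih β, comp_zero]

end CategoryTheory.Abelian.Ext

/-! ### Shifts, homogeneous submodules, and dévissage for graded modules. -/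

namespace GrMod

variable {k : Type v} {S : Type u} [Field k] [CommRing S] [Algebra k S] {𝒜 : ℤ → Submodule k S}

theorem mono_of_injective {X Y : GrMod 𝒜} (f : X ⟶ Y) (h : Function.Injective f.lin) : Mono f where
  right_cancellation g g' e := by
    ext x
    exact h (congrArg (fun m => Hom.lin m x) e)

theorem epi_of_surjective {X Y : GrMod 𝒜} (f : X ⟶ Y) (h : Function.Surjective f.lin) : Epi f where
  left_cancellation g g' e := by
    ext y
    obtain ⟨x, rfl⟩ := h y
    exact congrArg (fun m => Hom.lin m x) e

/-- The shift of a graded module. -/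
def shift (X : GrMod 𝒜) (d : ℤ) : GrMod 𝒜 where
  carrier := X.carrier
  piece i := X.piece (i + d)
  isInternal := isInternal_of_proj _ (fun i => X.proj (i + d)) (fun i x => X.proj_mem _ x)
    (fun i x hx => X.proj_of_mem _ x hx) (fun i j hij x hx => X.proj_of_ne _ _ (by lia) x hx)
    (fun x => by
      obtain ⟨s, hs⟩ := X.sum_proj x
      refine ⟨s.map (Equiv.subRight d).toEmbedding, ?_⟩
      simpa using hs s subset_rfl)
  smul_mem {i j a x} ha hx := by
    rw [add_assoc]
    exact X.smul_mem ha hx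

/-- The shift of a morphism. -/
def shiftMap {X Y : GrMod 𝒜} (f : X ⟶ Y) (d : ℤ) : X.shift d ⟶ Y.shift d :=
  ⟨f.lin, fun h => f.map_mem h⟩

/-- Shifting twice. -/
def shiftShift (X : GrMod 𝒜) {a b c : ℤ} (h : a + b = c) : (X.shift a).shift b ≅ X.shift c where
  hom := ⟨LinearMap.id, fun {i x} hx => by
    change x ∈ X.piece (i + b + a) at hx
    change x ∈ X.piece (i + c)
    rwa [show i + c = i + b + a by lia]⟩
  inv := ⟨LinearMap.id, fun {i x} hx => by
    change x ∈ X.piece (i + c) at hx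
    change x ∈ X.piece (i + b + a)
    rwa [show i + b + a = i + c by lia]⟩
  hom_inv_id := rfl
  inv_hom_id := rfl

/-- The shift by zero. -/
def shiftZero (X : GrMod 𝒜) : X.shift 0 ≅ X where
  hom := ⟨LinearMap.id, fun {i x} hx => by
    change x ∈ X.piece (i + 0) at hx
    change x ∈ X.piece i
    rwa [add_zero] at hx⟩
  inv := ⟨LinearMap.id, fun {i x} hx => by
    change x ∈ X.piece i at hx
    change x ∈ X.piece (i + 0)
    rwa [add_zero]⟩
  hom_inv_id := rfl
  inv_hom_id := rfl

/-- Multiplication by a homogeneous element. -/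
def mul (X : GrMod 𝒜) {d : ℤ} {a : S} (ha : a ∈ 𝒜 d) : X ⟶ X.shift d :=
  ⟨LinearMap.lsmul S X.carrier a, fun {i x} hx => by
    change a • x ∈ X.piece (i + d)
    rw [add_comm]
    exact X.smul_mem ha hx⟩

theorem mul_shiftMap {X Y : GrMod 𝒜} (f : X ⟶ Y) {d : ℤ} {a : S} (ha : a ∈ 𝒜 d) :
    X.mul ha ≫ shiftMap f d = f ≫ Y.mul ha := by
  ext x
  exact map_smul f.lin a x

theorem proj_smul (X : GrMod 𝒜) {i j l : ℤ} (h : i + j = l) {a : S} (ha : a ∈ 𝒜 i)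
    (x : X.carrier) : X.proj l (a • x) = a • X.proj j x := by
  subst h
  obtain ⟨s, hs⟩ := X.sum_proj x
  have h1 := hs (insert j s) (Finset.subset_insert _ _)
  nth_rw 1 [← h1]
  rw [Finset.smul_sum, map_sum, Finset.sum_eq_single j]
  · exact X.proj_of_mem _ _ (X.smul_mem ha (X.proj_mem j x))
  · intro l _ hl
    exact X.proj_of_ne _ (i + l) (by lia) _ (X.smul_mem ha (X.proj_mem l x))
  · intro hj
    simp at hj

/-- A submodule of a graded module is homogeneous if it contains the homogeneous components of its
elements. -/
def IsHomogeneous (X : GrMod 𝒜) (N : Submodule S X.carrier) : Prop :=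
  ∀ i, ∀ x ∈ N, X.proj i x ∈ N

theorem isHomogeneous_range {X Y : GrMod 𝒜} (f : X ⟶ Y) :
    Y.IsHomogeneous (LinearMap.range f.lin) := by
  rintro i _ ⟨x, rfl⟩
  exact ⟨X.proj i x, map_proj f i x⟩

theorem exists_homogeneous_preimage {X Y : GrMod 𝒜} (f : X ⟶ Y) {i : ℤ} {y : Y.carrier}
    (hy : y ∈ Y.piece i) (h : y ∈ LinearMap.range f.lin) : ∃ x ∈ X.piece i, f.lin x = y := by
  obtain ⟨x, rfl⟩ := h
  exact ⟨X.proj i x, X.proj_mem i x, by rw [map_proj, Y.proj_of_mem i _ hy]⟩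

theorem le_of_homogeneous {X : GrMod 𝒜} {N N' : Submodule S X.carrier} (hN : X.IsHomogeneous N)
    (h : ∀ i, ∀ x ∈ X.piece i, x ∈ N → x ∈ N') : N ≤ N' := by
  intro x hx
  obtain ⟨s, hs⟩ := X.sum_proj x
  rw [← hs s subset_rfl]
  exact sum_mem fun i _ => h i _ (X.proj_mem i x) (hN i x hx)

theorem isHomogeneous_sup_span {X : GrMod 𝒜} [GradedAlgebra 𝒜] {N : Submodule S X.carrier}
    (hN : X.IsHomogeneous N) {j : ℤ} {y : X.carrier} (hy : y ∈ X.piece j) :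
    X.IsHomogeneous (N ⊔ Submodule.span S {y}) := by
  classical
  intro i x hx
  obtain ⟨n, hn, z, hz, rfl⟩ := Submodule.mem_sup.mp hx
  obtain ⟨a, rfl⟩ := Submodule.mem_span_singleton.mp hz
  rw [map_add]
  refine add_mem (Submodule.mem_sup_left (hN i n hn)) (Submodule.mem_sup_right ?_)
  rw [← DirectSum.sum_support_decompose 𝒜 a, Finset.sum_smul, map_sum]
  refine sum_mem fun l _ => ?_
  rw [X.proj_smul (j := i - l) (by lia) (SetLike.coe_mem _)]
  refine Submodule.smul_mem _ _ ?_
  by_cases h : i - l = j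
  · rw [h, X.proj_of_mem _ _ hy]
    exact Submodule.mem_span_singleton_self y
  · rw [X.proj_of_ne _ _ h _ hy]
    exact zero_mem _

section Self

variable [GradedAlgebra 𝒜]

theorem proj_smul_of_mem (X : GrMod 𝒜) {i j l : ℤ} (h : i + j = l) {y : X.carrier}
    (hy : y ∈ X.piece j) (s : S) :
    X.proj l (s • y) = (DirectSum.decompose 𝒜 s i : S) • y := by
  classical
  subst h
  nth_rw 1 [← DirectSum.sum_support_decompose 𝒜 s]
  rw [Finset.sum_smul, map_sum, Finset.sum_eq_single i]
  · exact X.proj_of_mem _ _ (X.smul_mem (SetLike.coe_mem _) hy)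
  · intro l _ hl
    exact X.proj_of_ne _ (l + j) (by lia) _ (X.smul_mem (SetLike.coe_mem _) hy)
  · intro hi
    rw [DFinsupp.notMem_support_iff.mp hi]
    simp

variable (𝒜) in
/-- The ring as a graded module over itself. -/
noncomputable def self : GrMod 𝒜 where
  carrier := S
  piece i := (𝒜 i).toAddSubgroup
  isInternal := by
    classical
    exact isInternal_of_proj _ (fun i => GradedRing.proj 𝒜 i)
      (fun i x => SetLike.coe_mem _)
      (fun i x hx => DirectSum.decompose_of_mem_same 𝒜 hx)
      (fun i j hij x hx => DirectSum.decompose_of_mem_ne 𝒜 hx hij.symm)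
      (fun x => ⟨_, DirectSum.sum_support_decompose 𝒜 x⟩)
  smul_mem ha hx := SetLike.mul_mem_graded ha hx

variable (𝒜) in
/-- The shifted free module of rank one. -/
noncomputable abbrev selfShift (n : ℤ) : GrMod 𝒜 := (self 𝒜).shift n

theorem mem_selfShift_piece {n i : ℤ} {a : S} :
    a ∈ (selfShift 𝒜 n).piece i ↔ a ∈ 𝒜 (i + n) := Iff.rfl

theorem one_mem_selfShift (n : ℤ) : (1 : S) ∈ (selfShift 𝒜 n).piece (-n) := by
  rw [mem_selfShift_piece, neg_add_cancel]
  exact SetLike.one_mem_graded 𝒜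

/-- The morphism from a shifted free module given by a homogeneous element. -/
noncomputable def ofElem (X : GrMod 𝒜) {n j : ℤ} (h : j = -n) {x : X.carrier}
    (hx : x ∈ X.piece j) : selfShift 𝒜 n ⟶ X :=
  ⟨LinearMap.toSpanSingleton S X.carrier x, fun {i a} ha => by
    have h1 := X.smul_mem (mem_selfShift_piece.mp ha) hx
    rwa [show i + n + j = i by lia] at h1⟩

theorem proj_selfShift (n i : ℤ) (a : S) :
    (selfShift 𝒜 n).proj i a = (DirectSum.decompose 𝒜 a (i + n) : S) := by
  have h := (selfShift 𝒜 n).proj_smul_of_mem (i := i + n) (j := -n) (l := i) (by lia)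
    (y := show S from 1) (one_mem_selfShift (𝒜 := 𝒜) n) a
  have h1 : ∀ b : S, (LinearMap.toSpanSingleton S (selfShift 𝒜 n).carrier (show S from 1)) b = b :=
    fun b => mul_one (M := S) b
  exact (congrArg ((selfShift 𝒜 n).proj i) (h1 a)).symm.trans (h.trans (h1 _))

theorem isHomogeneous_selfShift_iff (n : ℤ) (I : Ideal S) :
    (selfShift 𝒜 n).IsHomogeneous I ↔ I.IsHomogeneous 𝒜 := by
  constructor
  · intro h i r hr
    have h1 := proj_selfShift (𝒜 := 𝒜) n (i - n) r
    rw [sub_add_cancel] at h1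
    exact h1 ▸ h (i - n) r hr
  · intro h i r hr
    exact (proj_selfShift (𝒜 := 𝒜) n i r).symm ▸ h _ hr

end Self

section Noetherian

variable [IsNoetherianRing S]

/-- The graded submodule given by a homogeneous submodule. -/
def sub (X : GrMod 𝒜) (N : Submodule S X.carrier) (hN : X.IsHomogeneous N) : GrMod 𝒜 where
  carrier := N
  piece i := (X.piece i).comap N.subtype.toAddMonoidHom
  isInternal := isInternal_of_proj _
    (fun i => ((X.proj i).comp N.subtype.toAddMonoidHom).codRestrict N fun x => hN i x x.2)
    (fun i x => X.proj_mem i x)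
    (fun i x hx => Subtype.ext (X.proj_of_mem i _ hx))
    (fun i j hij x hx => Subtype.ext (X.proj_of_ne i j hij _ hx))
    (fun x => by
      obtain ⟨s, hs⟩ := X.sum_proj x.1
      refine ⟨s, Subtype.ext ?_⟩
      rw [AddSubmonoidClass.coe_finsetSum]
      exact hs s subset_rfl)
  smul_mem ha hx := X.smul_mem ha hx

/-- The inclusion of a graded submodule. -/
def subι (X : GrMod 𝒜) (N : Submodule S X.carrier) (hN : X.IsHomogeneous N) : X.sub N hN ⟶ X :=
  ⟨N.subtype, fun h => h⟩

/-- The inclusion between graded submodules. -/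
def subMap (X : GrMod 𝒜) {N N' : Submodule S X.carrier} (hN : X.IsHomogeneous N)
    (hN' : X.IsHomogeneous N') (h : N ≤ N') : X.sub N hN ⟶ X.sub N' hN' :=
  ⟨Submodule.inclusion h, fun h => h⟩

/-- The corestriction of a morphism to a graded submodule. -/
def subLift {X Y : GrMod 𝒜} (f : Y ⟶ X) {N : Submodule S X.carrier} (hN : X.IsHomogeneous N)
    (h : ∀ y, f.lin y ∈ N) : Y ⟶ X.sub N hN :=
  ⟨f.lin.codRestrict N h, fun hx => f.map_mem hx⟩

theorem shortExact_of_exact {X Y Z : GrMod 𝒜} (f : X ⟶ Y) (g : Y ⟶ Z) (w : f ≫ g = 0)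
    (hf : Function.Injective f.lin) (hg : Function.Surjective g.lin)
    (h : ∀ y, g.lin y = 0 → y ∈ LinearMap.range f.lin) : (ShortComplex.mk f g w).ShortExact where
  exact := ShortComplex.exact_of_f_is_kernel _ (isLimitOfExact f g w hf h)
  mono_f := mono_of_injective f hf
  epi_g := epi_of_surjective g hg

theorem shortExact_coker {X Y : GrMod 𝒜} (f : X ⟶ Y) (hf : Function.Injective f.lin) :
    (ShortComplex.mk f (cokerπ f) (comp_cokerπ f)).ShortExact :=
  shortExact_of_exact _ _ _ hf (cokerπ_surjective f) fun y hy => (cokerπ_eq_zero_iff f y).mp hy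

theorem shortExact_ker {X Y : GrMod 𝒜} (f : X ⟶ Y) (hf : Function.Surjective f.lin) :
    (ShortComplex.mk (kerι f) f (kerι_comp f)).ShortExact :=
  shortExact_of_exact _ _ _ (kerι_injective f) hf fun y hy => mem_range_kerι f y hy

theorem shortExact_shift_ker {X Y : GrMod 𝒜} (f : X ⟶ Y) (hf : Function.Surjective f.lin) (d : ℤ) :
    (ShortComplex.mk (shiftMap (kerι f) d) (shiftMap f d)
      (congrArg (fun g => shiftMap g d) (kerι_comp f))).ShortExact :=
  shortExact_of_exact _ _ _ (kerι_injective f) hf fun y hy => mem_range_kerι f y hy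

theorem epiModSerre_iff {X Y : GrMod 𝒜} (f : X ⟶ Y) :
    (finiteLength 𝒜).epiModSerre f ↔ IsArtinian S (Y.carrier ⧸ LinearMap.range f.lin) := by
  rw [ObjectProperty.epiModSerre_iff]
  refine Iff.trans ?_ (finiteLength_iff (coker f))
  exact (finiteLength 𝒜).prop_iff_of_iso ((cokernelIsCokernel f).coconePointUniqueUpToIso
    (isColimitOfExact f (cokerπ f) (comp_cokerπ f) (cokerπ_surjective f)
      fun y hy => (cokerπ_eq_zero_iff f y).mp hy))

theorem monoModSerre_iff {X Y : GrMod 𝒜} (f : X ⟶ Y) :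
    (finiteLength 𝒜).monoModSerre f ↔ IsArtinian S (LinearMap.ker f.lin) := by
  rw [ObjectProperty.monoModSerre_iff]
  refine Iff.trans ?_ (finiteLength_iff (ker f))
  exact (finiteLength 𝒜).prop_iff_of_iso ((kernelIsKernel f).conePointUniqueUpToIso
    (isLimitOfExact (kerι f) f (kerι_comp f) (kerι_injective f) (mem_range_kerι f)))

theorem isoModSerre_of_injective {X Y : GrMod 𝒜} (f : X ⟶ Y) (hf : Function.Injective f.lin)
    (h : IsArtinian S (Y.carrier ⧸ LinearMap.range f.lin)) : (finiteLength 𝒜).isoModSerre f :=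
  have := mono_of_injective f hf
  ObjectProperty.isoModSerre_of_mono _ _ ((epiModSerre_iff f).mpr h)

variable [GradedAlgebra 𝒜]

/-- Dévissage: a property of graded modules that is stable under extensions and holds for all
graded modules that are generated by one homogeneous element with a prime annihilator. -/
theorem induction_of_cyclic (f : S) (C : GrMod 𝒜 → Prop)
    (zero : ∀ X : GrMod 𝒜, Subsingleton X.carrier → C X)
    (ext : ∀ T : ShortComplex (GrMod 𝒜), T.ShortExact → C T.X₁ → C T.X₃ → C T.X₂)
    (cyclic : ∀ (X : GrMod 𝒜) (j : ℤ) (x : X.carrier), x ∈ X.piece j → Submodule.span S {x} = ⊤ →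
      (Ideal.torsionOf S X.carrier x).IsPrime → f • x = 0 → C X)
    (X : GrMod 𝒜) (hX : ∀ x : X.carrier, f • x = 0) : C X := by
  have hbot : X.IsHomogeneous ⊥ := fun i x hx => by
    rw [Submodule.mem_bot] at hx ⊢
    rw [hx, map_zero]
  -- Take `N` maximal among the homogeneous submodules with the property. If `N ≠ ⊤`, it is enlarged
  -- below by one cyclic layer, a contradiction.
  obtain ⟨N, ⟨hN, hCN⟩, hmax⟩ := (wellFounded_gt (α := Submodule S X.carrier)).has_min
    {N | ∃ h : X.IsHomogeneous N, C (X.sub N h)}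
    ⟨⊥, hbot, zero _ (inferInstanceAs (Subsingleton (⊥ : Submodule S X.carrier)))⟩
  by_cases hNtop : N = ⊤
  · subst hNtop
    have e := shortExact_of_exact (X.subι ⊤ hN) (0 : X ⟶ zeroObj 𝒜) comp_zero
      Subtype.val_injective (fun y => ⟨0, Subsingleton.elim (α := PUnit) _ _⟩)
      (fun y _ => ⟨⟨y, trivial⟩, rfl⟩)
    exact ext _ e hCN (zero _ (inferInstanceAs (Subsingleton PUnit)))
  exfalso
  let I : X.carrier → Ideal S := fun y => N.comap (LinearMap.toSpanSingleton S X.carrier y)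
  have hI : ∀ y s, s ∈ I y ↔ s • y ∈ N := fun y s => Iff.rfl
  -- As for associated primes: a colon ideal `(N : y)` that is maximal among homogeneous `y ∉ N` is
  -- prime. Homogeneity of the ideal reduces primality to homogeneous factors.
  obtain ⟨_, ⟨j, y, hy, hyN, rfl⟩, hymax⟩ := (wellFounded_gt (α := Ideal S)).has_min
    {J | ∃ j, ∃ y ∈ X.piece j, y ∉ N ∧ I y = J} (by
      by_contra hne
      apply hNtop
      rw [eq_top_iff]
      refine le_of_homogeneous (fun _ _ _ => trivial) fun i x hx _ => ?_
      by_contra hxN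
      exact hne ⟨I x, i, x, hx, hxN, rfl⟩)
  have hhom : (I y).IsHomogeneous 𝒜 := by
    intro i s hs
    rw [hI] at hs ⊢
    rw [← X.proj_smul_of_mem rfl hy]
    exact hN _ _ hs
  have hprime : (I y).IsPrime := by
    refine Ideal.IsHomogeneous.isPrime_of_homogeneous_mem_or_mem hhom ?_ ?_
    · rw [Ne, Ideal.eq_top_iff_one, hI, one_smul]
      exact hyN
    · rintro a b ⟨i, ha⟩ ⟨l, hb⟩ hab
      by_contra! hne
      have hle : I y ≤ I (b • y) := fun s hs => by
        rw [hI, smul_comm]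
        exact N.smul_mem b hs
      have heq : ¬ I y < I (b • y) :=
        hymax (I (b • y)) ⟨_, b • y, X.smul_mem hb hy, hne.2, rfl⟩
      have : a ∈ I (b • y) := by
        rw [hI, ← mul_smul]
        exact hab
      exact hne.1 ((hle.eq_of_not_lt heq).symm ▸ this)
  have hN' := isHomogeneous_sup_span hN hy
  have hle : N ≤ N ⊔ Submodule.span S {y} := le_sup_left
  have hyN' : y ∈ N ⊔ Submodule.span S {y} :=
    Submodule.mem_sup_right (Submodule.mem_span_singleton_self y)
  let g := X.subMap hN hN' hle
  let z : (coker g).carrier := (cokerπ g).lin ⟨y, hyN'⟩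
  have hz : ∀ s : S, s • z = 0 ↔ s ∈ I y := by
    intro s
    have h1 : s • z = (cokerπ g).lin (s • ⟨y, hyN'⟩) := (map_smul _ _ _).symm
    rw [h1, cokerπ_eq_zero_iff]
    constructor
    · rintro ⟨n, hn⟩
      have : n.1 = s • y := congrArg Subtype.val hn
      rw [hI, ← this]
      exact n.2
    · intro hs
      exact ⟨⟨s • y, hs⟩, rfl⟩
  have hC : C (coker g) := by
    refine cyclic (coker g) j z ((cokerπ g).map_mem hy) ?_ ?_ ?_
    · rw [eq_top_iff]
      intro w _
      obtain ⟨⟨w, hw⟩, rfl⟩ := cokerπ_surjective g w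
      obtain ⟨n, hn, t, ht, rfl⟩ := Submodule.mem_sup.mp hw
      obtain ⟨a, rfl⟩ := Submodule.mem_span_singleton.mp ht
      have h0 : (cokerπ g).lin ⟨n, hle hn⟩ = 0 := (cokerπ_eq_zero_iff g _).mpr ⟨⟨n, hn⟩, rfl⟩
      refine Submodule.mem_span_singleton.mpr ⟨a, ?_⟩
      have h1 : (cokerπ g).lin ⟨n + a • y, hw⟩ = (cokerπ g).lin ⟨n, hle hn⟩ + a • z :=
        (map_add (cokerπ g).lin ⟨n, hle hn⟩ _).trans
          (congrArg _ (map_smul (cokerπ g).lin a ⟨y, hyN'⟩))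
      rw [h1, h0, zero_add]
    · have : Ideal.torsionOf S _ z = I y := by
        ext s
        rw [Ideal.mem_torsionOf_iff, hz]
      rw [this]
      exact hprime
    · rw [hz, hI, hX]
      exact zero_mem _
  have hC' := ext _ (shortExact_coker g (Submodule.inclusion_injective hle)) hCN hC
  refine hmax _ ⟨hN', hC'⟩ (lt_of_le_of_ne hle fun h => hyN ?_)
  rw [h]
  exact hyN'

end Noetherian

end GrMod

/-! ### The quotient functor to `QGr` and calculus of fractions. -/

open CategoryTheory.Abelian

namespace GrMod

variable {k : Type v} {S : Type u} [Field k] [CommRing S] [Algebra k S] {𝒜 : ℤ → Submodule k S}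
  [IsNoetherianRing S]

variable (𝒜) in
/-- The quotient functor from graded modules to `QGr`. -/
abbrev toQGr : GrMod 𝒜 ⥤ QGr 𝒜 := (finiteLength 𝒜).isoModSerre.Q

instance : PreservesFiniteLimits (toQGr 𝒜) :=
  ObjectProperty.SerreClassLocalization.preservesFiniteLimits _ (finiteLength 𝒜)

instance : PreservesFiniteColimits (toQGr 𝒜) :=
  ObjectProperty.SerreClassLocalization.preservesFiniteColimits _ (finiteLength 𝒜)

theorem isIso_toQGr_map_iff {X Y : GrMod 𝒜} (f : X ⟶ Y) :
    IsIso ((toQGr 𝒜).map f) ↔ (finiteLength 𝒜).isoModSerre f :=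
  ObjectProperty.SerreClassLocalization.isIso_map_iff _ _ f

theorem epi_toQGr_map_iff {X Y : GrMod 𝒜} (f : X ⟶ Y) :
    Epi ((toQGr 𝒜).map f) ↔ IsArtinian S (Y.carrier ⧸ LinearMap.range f.lin) :=
  (ObjectProperty.SerreClassLocalization.epi_map_iff _ _ f).trans (epiModSerre_iff f)

theorem mono_toQGr_map_iff {X Y : GrMod 𝒜} (f : X ⟶ Y) :
    Mono ((toQGr 𝒜).map f) ↔ IsArtinian S (LinearMap.ker f.lin) :=
  (ObjectProperty.SerreClassLocalization.mono_map_iff _ _ f).trans (monoModSerre_iff f)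

theorem isIso_toQGr_map_of_injective {X Y : GrMod 𝒜} (f : X ⟶ Y) (hf : Function.Injective f.lin)
    (h : IsArtinian S (Y.carrier ⧸ LinearMap.range f.lin)) : IsIso ((toQGr 𝒜).map f) :=
  (isIso_toQGr_map_iff f).mpr (isoModSerre_of_injective f hf h)

theorem isIso_toQGr_map_shiftMap {X Y : GrMod 𝒜} (f : X ⟶ Y) [h : IsIso ((toQGr 𝒜).map f)] (d : ℤ) :
    IsIso ((toQGr 𝒜).map (shiftMap f d)) := by
  rw [isIso_toQGr_map_iff, ObjectProperty.isoModSerre_iff, monoModSerre_iff, epiModSerre_iff] at h ⊢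
  exact h

theorem isZero_toQGr_obj {X : GrMod 𝒜} (h : IsArtinian S X.carrier) : IsZero ((toQGr 𝒜).obj X) :=
  (ObjectProperty.SerreClassLocalization.isZero_obj_iff _ (finiteLength 𝒜) X).mpr
    ((finiteLength_iff X).mpr h)

theorem shortExact_toQGr {T : ShortComplex (GrMod 𝒜)} (h : T.ShortExact) :
    (T.map (toQGr 𝒜)).ShortExact :=
  h.map_of_exact _

theorem exists_rightFraction {X Y : GrMod 𝒜} (φ : (toQGr 𝒜).obj X ⟶ (toQGr 𝒜).obj Y) :
    ∃ (X' : GrMod 𝒜) (s : X' ⟶ X) (f : X' ⟶ Y) (_ : IsIso ((toQGr 𝒜).map s)),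
      (toQGr 𝒜).map s ≫ φ = (toQGr 𝒜).map f := by
  obtain ⟨ψ, hψ⟩ := Localization.exists_rightFraction (toQGr 𝒜) (finiteLength 𝒜).isoModSerre φ
  refine ⟨ψ.X', ψ.s, ψ.f, (isIso_toQGr_map_iff _).mpr ψ.hs, ?_⟩
  rw [hψ, MorphismProperty.RightFraction.map_s_comp_map]

theorem exists_leftFraction {X Y : GrMod 𝒜} (φ : (toQGr 𝒜).obj X ⟶ (toQGr 𝒜).obj Y) :
    ∃ (Y' : GrMod 𝒜) (f : X ⟶ Y') (s : Y ⟶ Y') (_ : IsIso ((toQGr 𝒜).map s)),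
      φ ≫ (toQGr 𝒜).map s = (toQGr 𝒜).map f := by
  obtain ⟨ψ, hψ⟩ := Localization.exists_leftFraction (toQGr 𝒜) (finiteLength 𝒜).isoModSerre φ
  refine ⟨ψ.Y', ψ.f, ψ.s, (isIso_toQGr_map_iff _).mpr ψ.hs, ?_⟩
  rw [hψ, MorphismProperty.LeftFraction.map_comp_map_s]

/-- Every epimorphism onto the image of a graded module is dominated by the image of a morphism
of graded modules. -/
theorem exists_map_eq_comp_of_epi {X : GrMod 𝒜} {A : QGr 𝒜} (p : A ⟶ (toQGr 𝒜).obj X) [Epi p] :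
    ∃ (E : GrMod 𝒜) (g : E ⟶ X) (t : (toQGr 𝒜).obj E ⟶ A),
      t ≫ p = (toQGr 𝒜).map g ∧ IsArtinian S (X.carrier ⧸ LinearMap.range g.lin) := by
  have := Localization.essSurj (toQGr 𝒜) (finiteLength 𝒜).isoModSerre
  obtain ⟨E, s, g, hs, h⟩ := exists_rightFraction (((toQGr 𝒜).objObjPreimageIso A).hom ≫ p)
  refine ⟨E, g, (toQGr 𝒜).map s ≫ ((toQGr 𝒜).objObjPreimageIso A).hom, ?_, ?_⟩
  · rw [Category.assoc, h]
  · rw [← epi_toQGr_map_iff, ← h]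
    infer_instance

/-- The corestriction of a morphism to its range. -/
def toRange {X Y : GrMod 𝒜} (g : X ⟶ Y) : X ⟶ Y.sub _ (isHomogeneous_range g) :=
  subLift g (isHomogeneous_range g) fun x => ⟨x, rfl⟩

/-- The inclusion of the range of a morphism. -/
def rangeι {X Y : GrMod 𝒜} (g : X ⟶ Y) : Y.sub _ (isHomogeneous_range g) ⟶ Y :=
  Y.subι _ (isHomogeneous_range g)

theorem toRange_comp_rangeι {X Y : GrMod 𝒜} (g : X ⟶ Y) : toRange g ≫ rangeι g = g := rfl

theorem toRange_surjective {X Y : GrMod 𝒜} (g : X ⟶ Y) : Function.Surjective (toRange g).lin := by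
  rintro ⟨_, x, rfl⟩
  exact ⟨x, rfl⟩

theorem rangeι_injective {X Y : GrMod 𝒜} (g : X ⟶ Y) : Function.Injective (rangeι g).lin :=
  Subtype.val_injective

theorem range_rangeι {X Y : GrMod 𝒜} (g : X ⟶ Y) :
    LinearMap.range (rangeι g).lin = LinearMap.range g.lin :=
  Submodule.range_subtype _

theorem isIso_rangeι {X Y : GrMod 𝒜} (g : X ⟶ Y)
    (h : IsArtinian S (Y.carrier ⧸ LinearMap.range g.lin)) : IsIso ((toQGr 𝒜).map (rangeι g)) :=
  isIso_toQGr_map_of_injective _ (rangeι_injective g) (by rwa [range_rangeι])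

variable [HasExt.{w} (QGr 𝒜)]

theorem comp_mk₀_injective {C : Type*} [Category C] [Abelian C] [HasExt.{w} C] {X Y Z : C} {n : ℕ}
    (f : Y ⟶ Z) [IsIso f] {α β : Ext X Y n}
    (h : α.comp (Ext.mk₀ f) (add_zero n) = β.comp (Ext.mk₀ f) (add_zero n)) : α = β := by
  have h1 := congrArg (fun z => z.comp (Ext.mk₀ (inv f)) (add_zero n)) h
  simpa using h1

theorem mk₀_comp_injective {C : Type*} [Category C] [Abelian C] [HasExt.{w} C] {X Y Z : C} {n : ℕ}
    (f : X ⟶ Y) [IsIso f] {α β : Ext Y Z n}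
    (h : (Ext.mk₀ f).comp α (zero_add n) = (Ext.mk₀ f).comp β (zero_add n)) : α = β := by
  have h1 := congrArg (fun z => (Ext.mk₀ (inv f)).comp z (zero_add n)) h
  simpa using h1

/-! ### Long exact Ext sequences in `QGr`. -/

section ShortExact

variable {X Y Z : GrMod 𝒜} {f : X ⟶ Y} {g : Y ⟶ Z} {w : f ≫ g = 0}
  (h : (ShortComplex.mk f g w).ShortExact) {n m : ℕ} (hn : n + 1 = m)

/-- The class in `QGr` of a short exact sequence of graded modules. -/
noncomputable def extClass : Ext ((toQGr 𝒜).obj Z) ((toQGr 𝒜).obj X) 1 :=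
  (shortExact_toQGr h).extClass

include h

theorem covariant_exact₁ {W : QGr 𝒜} (α : Ext W ((toQGr 𝒜).obj X) m)
    (hα : α.comp (Ext.mk₀ ((toQGr 𝒜).map f)) (add_zero m) = 0) :
    ∃ β : Ext W ((toQGr 𝒜).obj Z) n, β.comp (extClass h) hn = α :=
  Ext.covariant_sequence_exact₁ _ (shortExact_toQGr h) α hα hn

theorem covariant_exact₂ {W : QGr 𝒜} (α : Ext W ((toQGr 𝒜).obj Y) n)
    (hα : α.comp (Ext.mk₀ ((toQGr 𝒜).map g)) (add_zero n) = 0) :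
    ∃ β : Ext W ((toQGr 𝒜).obj X) n, β.comp (Ext.mk₀ ((toQGr 𝒜).map f)) (add_zero n) = α :=
  Ext.covariant_sequence_exact₂ _ (shortExact_toQGr h) α hα

theorem covariant_exact₃ {W : QGr 𝒜} (α : Ext W ((toQGr 𝒜).obj Z) n)
    (hα : α.comp (extClass h) hn = 0) :
    ∃ β : Ext W ((toQGr 𝒜).obj Y) n, β.comp (Ext.mk₀ ((toQGr 𝒜).map g)) (add_zero n) = α :=
  Ext.covariant_sequence_exact₃ _ (shortExact_toQGr h) α hn hα

theorem contravariant_exact₁ {W : QGr 𝒜} (α : Ext ((toQGr 𝒜).obj X) W n)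
    (hα : (extClass h).comp α ((add_comm 1 n).trans hn) = 0) :
    ∃ β : Ext ((toQGr 𝒜).obj Y) W n, (Ext.mk₀ ((toQGr 𝒜).map f)).comp β (zero_add n) = α :=
  Ext.contravariant_sequence_exact₁ (shortExact_toQGr h) _ α _ hα

theorem contravariant_exact₂ {W : QGr 𝒜} (α : Ext ((toQGr 𝒜).obj Y) W n)
    (hα : (Ext.mk₀ ((toQGr 𝒜).map f)).comp α (zero_add n) = 0) :
    ∃ β : Ext ((toQGr 𝒜).obj Z) W n, (Ext.mk₀ ((toQGr 𝒜).map g)).comp β (zero_add n) = α :=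
  Ext.contravariant_sequence_exact₂ (shortExact_toQGr h) _ α hα

theorem contravariant_exact₃ {W : QGr 𝒜} (α : Ext ((toQGr 𝒜).obj Z) W m)
    (hα : (Ext.mk₀ ((toQGr 𝒜).map g)).comp α (zero_add m) = 0) :
    ∃ β : Ext ((toQGr 𝒜).obj X) W n, (extClass h).comp β ((add_comm 1 n).trans hn) = α :=
  Ext.contravariant_sequence_exact₃ (shortExact_toQGr h) _ α hα _

theorem map_comp_extClass_comp {W : QGr 𝒜} (α : Ext ((toQGr 𝒜).obj X) W n) :
    (Ext.mk₀ ((toQGr 𝒜).map g)).comp ((extClass h).comp α ((add_comm 1 n).trans hn)) (zero_add m)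
      = 0 :=
  (shortExact_toQGr h).comp_extClass_assoc α _

theorem extClass_comp_map_comp {W : QGr 𝒜} (α : Ext ((toQGr 𝒜).obj Y) W n) :
    (extClass h).comp ((Ext.mk₀ ((toQGr 𝒜).map f)).comp α (zero_add n))
      ((add_comm 1 n).trans hn) = 0 :=
  (shortExact_toQGr h).extClass_comp_assoc α

theorem extClass_naturality {X' Y' Z' : GrMod 𝒜} {f' : X' ⟶ Y'} {g' : Y' ⟶ Z'} {w' : f' ≫ g' = 0}
    (h' : (ShortComplex.mk f' g' w').ShortExact) (a : X ⟶ X') (b : Y ⟶ Y') (c : Z ⟶ Z')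
    (hab : a ≫ f' = f ≫ b) (hbc : b ≫ g' = g ≫ c) :
    (extClass h).comp (Ext.mk₀ ((toQGr 𝒜).map a)) (add_zero 1) =
      (Ext.mk₀ ((toQGr 𝒜).map c)).comp (extClass h') (zero_add 1) :=
  (shortExact_toQGr h).extClass_naturality (shortExact_toQGr h')
    ((toQGr 𝒜).mapShortComplex.map
      { τ₁ := a, τ₂ := b, τ₃ := c, comm₁₂ := hab, comm₂₃ := hbc })

end ShortExact

/-- A class of positive degree restricted to the range of a suitable morphism is the
composition of a class of lower degree with the class of a short exact sequence of graded
modules. -/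
theorem exists_restrict_eq_extClass_comp {X Y : GrMod 𝒜} {n : ℕ}
    (α : Ext ((toQGr 𝒜).obj X) ((toQGr 𝒜).obj Y) (n + 1)) :
    ∃ (E : GrMod 𝒜) (g : E ⟶ X) (_ : IsArtinian S (X.carrier ⧸ LinearMap.range g.lin))
      (β : Ext ((toQGr 𝒜).obj (ker (toRange g))) ((toQGr 𝒜).obj Y) n),
      (extClass (shortExact_ker _ (toRange_surjective g))).comp β (add_comm 1 n) =
        (Ext.mk₀ ((toQGr 𝒜).map (rangeι g))).comp α (zero_add _) := by
  -- The effacing epimorphism lives in `QGr`; it is dominated by a module map `g`, which therefore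
  -- also kills `α`.
  obtain ⟨A, p, _, hp⟩ := α.exists_epi_comp_eq_zero
  obtain ⟨E, g, t, ht, hg⟩ := exists_map_eq_comp_of_epi p
  refine ⟨E, g, hg, contravariant_exact₃ (shortExact_ker _ (toRange_surjective g)) rfl _ ?_⟩
  rw [Ext.mk₀_comp_mk₀_assoc, ← Functor.map_comp, toRange_comp_rangeι, ← ht,
    ← Ext.mk₀_comp_mk₀_assoc, hp, Ext.comp_zero]

/-! ### Transport of Ext classes along shifts, and annihilation by homogeneous elements. -/

variable {d : ℤ} {a : S} (ha : a ∈ 𝒜 d)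

/-- Transport of extension classes along the shift, compatible with the multiplication by a
homogeneous element: an inductive step. -/
theorem exists_shift_ext_succ {n : ℕ}
    (ih : ∀ (X Y : GrMod 𝒜) (α : Ext ((toQGr 𝒜).obj X) ((toQGr 𝒜).obj Y) n),
      ∃ α' : Ext ((toQGr 𝒜).obj (X.shift d)) ((toQGr 𝒜).obj (Y.shift d)) n,
        (Ext.mk₀ ((toQGr 𝒜).map (X.mul ha))).comp α' (zero_add n) =
          α.comp (Ext.mk₀ ((toQGr 𝒜).map (Y.mul ha))) (add_zero n))
    {X Y E : GrMod 𝒜} (α : Ext ((toQGr 𝒜).obj X) ((toQGr 𝒜).obj Y) (n + 1)) (g : E ⟶ X)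
    (hg : IsArtinian S (X.carrier ⧸ LinearMap.range g.lin))
    (β : Ext ((toQGr 𝒜).obj (ker (toRange g))) ((toQGr 𝒜).obj Y) n)
    (hβ : (extClass (shortExact_ker _ (toRange_surjective g))).comp β
      (add_comm 1 n) = (Ext.mk₀ ((toQGr 𝒜).map (rangeι g))).comp α (zero_add _)) :
    ∃ α' : Ext ((toQGr 𝒜).obj (X.shift d)) ((toQGr 𝒜).obj (Y.shift d)) (n + 1),
      (Ext.mk₀ ((toQGr 𝒜).map (X.mul ha))).comp α' (zero_add _) =
        α.comp (Ext.mk₀ ((toQGr 𝒜).map (Y.mul ha))) (add_zero _) ∧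
      (Ext.mk₀ ((toQGr 𝒜).map (shiftMap g d))).comp α' (zero_add _) = 0 := by
  obtain ⟨β', hβ'⟩ := ih _ _ β
  have h1 := shortExact_ker _ (toRange_surjective g)
  have h2 := shortExact_shift_ker _ (toRange_surjective g) d
  have := isIso_rangeι g hg
  have := isIso_toQGr_map_shiftMap (rangeι g) d
  have hnat := extClass_naturality h1 h2 (GrMod.mul _ ha) (GrMod.mul _ ha) (GrMod.mul _ ha)
    (mul_shiftMap _ ha) (mul_shiftMap _ ha)
  -- The shifted kernel sequence composed with the transported `β'` is the transport of `α`
  -- restricted to the range of `g`. The range inclusion is invertible in `QGr`, also after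
  -- shifting, which gives `α'`; the shift of `g` kills it because consecutive maps of the Ext
  -- sequence compose to zero.
  let γ := (extClass h2).comp β' (add_comm 1 n)
  have hγ : (Ext.mk₀ ((toQGr 𝒜).map ((X.sub _ (isHomogeneous_range g)).mul ha))).comp γ
      (zero_add _) = (Ext.mk₀ ((toQGr 𝒜).map (rangeι g))).comp
        (α.comp (Ext.mk₀ ((toQGr 𝒜).map (Y.mul ha))) (add_zero _)) (zero_add _) := by
    rw [← Ext.comp_assoc_of_third_deg_zero, ← hβ, Ext.comp_assoc_of_third_deg_zero, ← hβ',
      ← Ext.comp_assoc_of_second_deg_zero, hnat, Ext.comp_assoc (h₁₂ := zero_add 1)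
      (h := by lia)]
  refine ⟨(Ext.mk₀ (inv ((toQGr 𝒜).map (shiftMap (rangeι g) d)))).comp γ (zero_add _), ?_, ?_⟩
  · apply mk₀_comp_injective ((toQGr 𝒜).map (rangeι g))
    rw [← hγ, Ext.mk₀_comp_mk₀_assoc, Ext.mk₀_comp_mk₀_assoc,
      ← Functor.map_comp, ← mul_shiftMap, Functor.map_comp, Category.assoc, IsIso.hom_inv_id,
      Category.comp_id]
  · rw [Ext.mk₀_comp_mk₀_assoc]
    have : shiftMap g d = shiftMap (toRange g) d ≫ shiftMap (rangeι g) d := rfl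
    rw [this, Functor.map_comp, Category.assoc, IsIso.hom_inv_id, Category.comp_id]
    exact map_comp_extClass_comp h2 rfl β'

/-- In degree zero, write the morphism as a fraction and shift both legs; higher degrees follow by
splitting off short exact sequences of modules. Only existence of a compatible class is needed. -/
theorem exists_shift_ext {n : ℕ} {X Y : GrMod 𝒜}
    (α : Ext ((toQGr 𝒜).obj X) ((toQGr 𝒜).obj Y) n) :
    ∃ α' : Ext ((toQGr 𝒜).obj (X.shift d)) ((toQGr 𝒜).obj (Y.shift d)) n,
      (Ext.mk₀ ((toQGr 𝒜).map (X.mul ha))).comp α' (zero_add n) =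
        α.comp (Ext.mk₀ ((toQGr 𝒜).map (Y.mul ha))) (add_zero n) := by
  induction n generalizing X Y with
  | zero =>
    obtain ⟨φ, rfl⟩ := (Ext.mk₀_bijective _ _).2 α
    obtain ⟨X', s, f, _, h⟩ := exists_rightFraction φ
    have := isIso_toQGr_map_shiftMap s d
    refine ⟨Ext.mk₀ (inv ((toQGr 𝒜).map (shiftMap s d)) ≫ (toQGr 𝒜).map (shiftMap f d)), ?_⟩
    rw [Ext.mk₀_comp_mk₀, Ext.mk₀_comp_mk₀]
    congr 1
    rw [← cancel_epi ((toQGr 𝒜).map s), reassoc_of% h, ← Functor.map_comp, ← mul_shiftMap,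
      ← Functor.map_comp_assoc, ← mul_shiftMap, Functor.map_comp_assoc, IsIso.hom_inv_id_assoc,
      Functor.map_comp]
  | succ n ih =>
    obtain ⟨E, g, hg, β, hβ⟩ := exists_restrict_eq_extClass_comp α
    obtain ⟨α', h, _⟩ := exists_shift_ext_succ ha (fun _ _ => ih) α g hg β hβ
    exact ⟨α', h⟩

/-- Every class of positive degree is killed by a morphism of graded modules with cokernel of finite
length, and this persists after every shift. -/
theorem exists_comp_eq_zero {n : ℕ} {X Y : GrMod 𝒜}
    (α : Ext ((toQGr 𝒜).obj X) ((toQGr 𝒜).obj Y) (n + 1)) :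
    ∃ (E : GrMod 𝒜) (g : E ⟶ X), IsArtinian S (X.carrier ⧸ LinearMap.range g.lin) ∧
      ∀ (d : ℤ) (a : S) (ha : a ∈ 𝒜 d),
        ∃ α' : Ext ((toQGr 𝒜).obj (X.shift d)) ((toQGr 𝒜).obj (Y.shift d)) (n + 1),
          (Ext.mk₀ ((toQGr 𝒜).map (X.mul ha))).comp α' (zero_add _) =
            α.comp (Ext.mk₀ ((toQGr 𝒜).map (Y.mul ha))) (add_zero _) ∧
          (Ext.mk₀ ((toQGr 𝒜).map (shiftMap g d))).comp α' (zero_add _) = 0 := by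
  obtain ⟨E, g, hg, β, hβ⟩ := exists_restrict_eq_extClass_comp α
  exact ⟨E, g, hg, fun d a ha => exists_shift_ext_succ ha
    (fun _ _ => exists_shift_ext ha) α g hg β hβ⟩

omit [IsNoetherianRing S] in
theorem isMaximal_of_isArtinian_quotient {P : Ideal S} [P.IsPrime] (h : IsArtinian S (S ⧸ P)) :
    P.IsMaximal := by
  have : IsArtinianRing (S ⧸ P) := isArtinian_of_tower S h
  exact Ideal.Quotient.maximal_of_isField P (IsArtinianRing.isField_of_isDomain (S ⧸ P))

variable [GradedAlgebra 𝒜]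

/-- A class of positive degree on a free module of rank one is killed by some homogeneous element
outside of a given non-maximal prime ideal. -/
theorem exists_comp_mul_eq_zero (P : Ideal S) [P.IsPrime] (hP : ¬ P.IsMaximal) {m : ℤ} {n : ℕ}
    {Y : GrMod 𝒜} (α : Ext ((toQGr 𝒜).obj (selfShift 𝒜 m)) ((toQGr 𝒜).obj Y) (n + 1)) :
    ∃ (d : ℤ) (a : S) (ha : a ∈ 𝒜 d), a ∉ P ∧
      α.comp (Ext.mk₀ ((toQGr 𝒜).map (Y.mul ha))) (add_zero _) = 0 := by
  obtain ⟨E, g, hg, h⟩ := exists_comp_eq_zero α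
  -- Otherwise `S ⧸ P` is a quotient of the artinian cokernel of `g`, and `P` is maximal.
  have hle : ¬ LinearMap.range g.lin ≤ P := fun hle => by
    apply hP
    apply isMaximal_of_isArtinian_quotient
    let N : Submodule S S := LinearMap.range g.lin
    have : IsArtinian S (S ⧸ N) := hg
    exact isArtinian_of_surjective (S ⧸ N) (Submodule.factor hle) (Submodule.factor_surjective hle)
  obtain ⟨i, a, hai, hag, haP⟩ : ∃ i, ∃ a ∈ (selfShift 𝒜 m).piece i,
      a ∈ LinearMap.range g.lin ∧ a ∉ P := by
    by_contra! hne
    exact hle (le_of_homogeneous (isHomogeneous_range g) hne)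
  obtain ⟨e, he, rfl⟩ := exists_homogeneous_preimage g hai hag
  let a : S := g.lin e
  have ha : a ∈ 𝒜 (i + m) := hai
  obtain ⟨α', h1, h2⟩ := h (i + m) a ha
  refine ⟨i + m, a, ha, haP, ?_⟩
  have he' : e ∈ (E.shift (i + m)).piece (-m) := by
    change e ∈ E.piece (-m + (i + m))
    rwa [show -m + (i + m) = i by lia]
  -- Since `a = g e`, multiplication by `a` is `1 ↦ e` followed by `g`.
  have hfac : (selfShift 𝒜 m).mul ha = ofElem _ rfl he' ≫ shiftMap g (i + m) := by
    ext b
    exact (mul_comm a b).trans (map_smul g.lin (show S from b) e).symm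
  rw [← h1, hfac, Functor.map_comp, ← Ext.mk₀_comp_mk₀_assoc, h2, Ext.comp_zero]

end GrMod

/-! ### Commutative algebra of two-dimensional noetherian domains. -/

namespace GrMod

section Domain

variable {S : Type u} [CommRing S] [IsDomain S]

/-- Otherwise `⊥ < P < P' < m`, with `m` maximal, is a chain of length 3. -/
theorem isMaximal_of_ringKrullDim_eq_two (hdim : ringKrullDim S = 2) {P P' : Ideal S} [P.IsPrime]
    [P'.IsPrime] (hP : P ≠ ⊥) (h : P < P') : P'.IsMaximal := by
  by_contra hmax
  obtain ⟨m, hm, hle⟩ := Ideal.exists_le_maximal P' (Ideal.IsPrime.ne_top inferInstance)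
  have hlt : P' < m := lt_of_le_of_ne hle (by rintro rfl; exact hmax hm)
  let p0 : PrimeSpectrum S := ⟨⊥, Ideal.isPrime_bot⟩
  let p1 : PrimeSpectrum S := ⟨P, inferInstance⟩
  let p2 : PrimeSpectrum S := ⟨P', inferInstance⟩
  let p3 : PrimeSpectrum S := ⟨m, hm.isPrime⟩
  have h01 : p0 < p1 := (bot_lt_iff_ne_bot.mpr hP : (⊥ : Ideal S) < P)
  have h12 : p1 < p2 := h
  have h23 : p2 < p3 := hlt
  let s : LTSeries (PrimeSpectrum S) :=
    RelSeries.fromListIsChain [p0, p1, p2, p3] (by simp) (by simp [h01, h12, h23])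
  have := Order.LTSeries.length_le_krullDim s
  rw [show Order.krullDim (PrimeSpectrum S) = 2 from hdim] at this
  have h3 : s.length = 3 := rfl
  rw [h3] at this
  exact absurd this (by decide)

theorem not_isMaximal_bot (hdim : ringKrullDim S = 2) : ¬ (⊥ : Ideal S).IsMaximal := by
  intro h
  have := Ring.isField_iff_maximal_bot.mpr h
  rw [ringKrullDim_eq_zero_of_isField this] at hdim
  exact absurd hdim (by decide)

theorem height_le_one (hdim : ringKrullDim S = 2) {P : Ideal S} [P.IsPrime] (hP : ¬ P.IsMaximal) :
    P.height ≤ 1 := by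
  refine Ideal.height_le_iff.mpr fun Q hQ hlt => ?_
  have : Q = ⊥ := by
    by_contra hne
    exact hP (isMaximal_of_ringKrullDim_eq_two hdim hne hlt)
  rw [this, Ideal.height_bot]
  exact zero_lt_one

variable [IsNoetherianRing S]

/-- The module is a quotient of `S ⧸ (P + a)`. Primes above `P + a` strictly contain `P ≠ ⊥`, so
they are maximal, and a noetherian ring of dimension zero is artinian. -/
theorem isArtinian_of_span_singleton (hdim : ringKrullDim S = 2) {P : Ideal S} [P.IsPrime]
    (hP : P ≠ ⊥) {a : S} (ha : a ∉ P) {M : Type*} [AddCommGroup M] [Module S M] {x : M}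
    (hx : Submodule.span S {x} = ⊤) (hPx : ∀ p ∈ P, p • x = 0) (hax : a • x = 0) :
    IsArtinian S M := by
  let I := P ⊔ Ideal.span {a}
  have : IsArtinianRing (S ⧸ I) := by
    refine isArtinianRing_iff_isNoetherianRing_krullDimLE_zero.mpr
      ⟨inferInstance, Ring.KrullDimLE.mk₀ fun J hJ => ?_⟩
    have hIJ : I ≤ J.comap (Ideal.Quotient.mk I) := fun i hi => by
      rw [Ideal.mem_comap, Ideal.Quotient.eq_zero_iff_mem.mpr hi]
      exact zero_mem _
    have hlt : P < J.comap (Ideal.Quotient.mk I) := by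
      refine lt_of_le_of_ne (le_sup_left.trans hIJ) fun h => ha ?_
      rw [h]
      exact hIJ (Ideal.mem_sup_right (Ideal.mem_span_singleton_self a))
    have := isMaximal_of_ringKrullDim_eq_two hdim hP hlt
    have h := (Ideal.map_eq_top_or_isMaximal_of_surjective (Ideal.Quotient.mk I)
      Ideal.Quotient.mk_surjective this)
    rw [Ideal.map_comap_of_surjective _ Ideal.Quotient.mk_surjective] at h
    exact h.resolve_left hJ.ne_top
  have h1 : IsArtinian S (S ⧸ I) := isArtinian_of_surjective_algebraMap
    (show Function.Surjective (algebraMap S (S ⧸ I)) from Ideal.Quotient.mk_surjective)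
  have hle : I ≤ LinearMap.ker (LinearMap.toSpanSingleton S M x) :=
    sup_le hPx ((Ideal.span_singleton_le_iff_mem _).mpr hax)
  refine isArtinian_of_surjective (S ⧸ I) (Submodule.liftQ I _ hle) ?_
  rw [← LinearMap.range_eq_top, Submodule.range_liftQ, LinearMap.range_toSpanSingleton, hx]

omit [IsDomain S] [IsNoetherianRing S] in
-- Modulo its annihilator, `S` embeds in a finite power of `M` by acting on generators. If `P`
-- contained the annihilator, `S ⧸ P` would be artinian.
theorem exists_notMem_smul_eq_zero {P : Ideal S} [P.IsPrime] (hP : ¬ P.IsMaximal) {M : Type*}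
    [AddCommGroup M] [Module S M] [Module.Finite S M] [IsArtinian S M] :
    ∃ c ∉ P, ∀ x : M, c • x = 0 := by
  by_contra! hne
  apply hP
  apply isMaximal_of_isArtinian_quotient
  obtain ⟨n, g, hg⟩ := Module.Finite.exists_fin (R := S) (M := M)
  let φ : S →ₗ[S] (Fin n → M) := LinearMap.pi fun i => LinearMap.toSpanSingleton S M (g i)
  have hle : LinearMap.ker φ ≤ P := by
    intro c hc
    by_contra hcP
    obtain ⟨x, hx⟩ := hne c hcP
    apply hx
    have hle : Submodule.span S (Set.range g) ≤ LinearMap.ker (LinearMap.lsmul S M c) := by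
      rw [Submodule.span_le]
      rintro _ ⟨i, rfl⟩
      exact congrFun hc i
    exact hle (hg ▸ Submodule.mem_top)
  have : IsArtinian S (S ⧸ LinearMap.ker φ) :=
    isArtinian_of_injective _
      (LinearMap.ker_eq_bot.mp (Submodule.ker_liftQ_eq_bot _ φ le_rfl le_rfl))
  exact isArtinian_of_surjective _ (Submodule.factor hle) (Submodule.factor_surjective hle)

omit [IsDomain S] [IsNoetherianRing S] in
theorem exists_notMem_forall_mul_mem {P : Ideal S} [P.IsPrime] (J : Ideal S) {I : Ideal S}
    (hI : I.FG) (h : ∀ p ∈ I, ∃ t ∉ P, t * p ∈ J) : ∃ t ∉ P, ∀ p ∈ I, t * p ∈ J := by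
  induction I, hI using Submodule.fg_induction with
  | singleton x =>
    obtain ⟨t, ht, htx⟩ := h x (Submodule.mem_span_singleton_self x)
    refine ⟨t, ht, fun p hp => ?_⟩
    obtain ⟨a, rfl⟩ := Submodule.mem_span_singleton.mp hp
    rw [smul_eq_mul, mul_left_comm]
    exact J.mul_mem_left a htx
  | sup N₁ N₂ _ _ h₁ h₂ =>
    obtain ⟨t₁, ht₁, h₁⟩ := h₁ fun p hp => h p (Submodule.mem_sup_left hp)
    obtain ⟨t₂, ht₂, h₂⟩ := h₂ fun p hp => h p (Submodule.mem_sup_right hp)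
    refine ⟨t₁ * t₂, fun hmem => (Ideal.IsPrime.mem_or_mem inferInstance hmem).elim ht₁ ht₂,
      fun p hp => ?_⟩
    obtain ⟨p₁, hp₁, p₂, hp₂, rfl⟩ := Submodule.mem_sup.mp hp
    have := add_mem (J.mul_mem_left t₂ (h₁ p₁ hp₁)) (J.mul_mem_left t₁ (h₂ p₂ hp₂))
    convert this using 1
    ring

/-- The maximal ideal of the localization is generated by `y`, and a noetherian local domain with
principal maximal ideal is a principal ideal ring, hence regular. -/
theorem isRegularLocalRing_of_forall_mul_mem {P : Ideal S} [P.IsPrime] (y : S) (hy : y ∈ P)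
    (h : ∀ p ∈ P, ∃ t ∉ P, t * p ∈ Ideal.span {y}) :
    IsRegularLocalRing (Localization.AtPrime P) := by
  have hm : (IsLocalRing.maximalIdeal (Localization.AtPrime P)).IsPrincipal := by
    refine ⟨⟨algebraMap S _ y, ?_⟩⟩
    rw [← Localization.AtPrime.map_eq_maximalIdeal]
    apply le_antisymm
    · rw [Ideal.map_le_iff_le_comap]
      intro p hp
      rw [Ideal.mem_comap, Ideal.submodule_span_eq, ← Set.image_singleton, ← Ideal.map_span]
      obtain ⟨t, ht, hmem⟩ := h p hp
      exact (IsLocalization.algebraMap_mem_map_algebraMap_iff P.primeCompl _ _ _).mpr ⟨t, ht, hmem⟩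
    · exact (Ideal.span_singleton_le_iff_mem _).mpr (Ideal.mem_map_of_mem _ hy)
  have := IsLocalization.isDomain_localization (M := P.primeCompl) P.primeCompl_le_nonZeroDivisors
  have : IsPrincipalIdealRing (Localization.AtPrime P) :=
    ((tfae_of_isNoetherianRing_of_isLocalRing_of_isDomain _).out 0 4).mpr hm
  infer_instance

/-- A regular local ring at a prime of height one has a uniformizer in any set of generators. -/
theorem exists_forall_mul_mem_span_singleton (hdim : ringKrullDim S = 2) {P : Ideal S} [P.IsPrime]
    (hP : P ≠ ⊥) (hPm : ¬ P.IsMaximal) [hreg : IsRegularLocalRing (Localization.AtPrime P)]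
    {G : Set S} (hG : Ideal.span G = P) : ∃ f ∈ G, ∃ t ∉ P, ∀ p ∈ P, t * p ∈ Ideal.span {f} := by
  let R := Localization.AtPrime P
  let m := IsLocalRing.maximalIdeal R
  have hmap : P.map (algebraMap S R) = m := Localization.AtPrime.map_eq_maximalIdeal
  have hinj : Function.Injective (algebraMap S R) :=
    IsLocalization.injective R P.primeCompl_le_nonZeroDivisors
  have hm0 : m ≠ ⊥ := by
    intro h
    rw [← hmap, Ideal.map_eq_bot_iff_of_injective hinj] at h
    exact hP h
  have hfin : m.spanFinrank = 1 := by
    have h1 : ((m.spanFinrank : ℕ) : WithBot ℕ∞) ≤ 1 := by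
      have := hreg.spanFinrank_maximalIdeal
      rw [IsLocalization.AtPrime.ringKrullDim_eq_height P] at this
      refine this.le.trans ?_
      exact_mod_cast height_le_one hdim hPm
    have h2 : m.spanFinrank ≤ 1 := by exact_mod_cast h1
    have h3 : m.spanFinrank ≠ 0 := fun h =>
      hm0 ((Submodule.spanFinrank_eq_zero_iff_eq_bot (IsNoetherian.noetherian m)).mp h)
    omega
  obtain ⟨⟨ϖ, hϖ⟩⟩ := ((Submodule.spanFinrank_eq_one_iff _).mp hfin).1
  -- By Nakayama the generators cannot all lie in `m * m`; one outside it is a unit times `ϖ`.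
  obtain ⟨f, hfG, hf⟩ : ∃ f ∈ G, algebraMap S R f ∉ m * m := by
    by_contra! hne
    have hle : m ≤ m * m := by
      refine hmap.symm.le.trans ?_
      rw [Ideal.map_le_iff_le_comap]
      refine hG.symm.le.trans ?_
      rw [Ideal.span_le]
      exact hne
    exact hm0 (Submodule.eq_bot_of_le_smul_of_le_jacobson_bot m m (IsNoetherian.noetherian m) hle
      (IsLocalRing.maximalIdeal_le_jacobson ⊥))
  have hfP : f ∈ P := hG ▸ Ideal.subset_span hfG
  have hfm : algebraMap S R f ∈ m := hmap ▸ Ideal.mem_map_of_mem _ hfP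
  have hmϖ : m = Ideal.span {ϖ} := hϖ
  obtain ⟨w, hw⟩ := Ideal.mem_span_singleton'.mp (hmϖ ▸ hfm)
  have hwu : IsUnit w := by
    by_contra hwu
    refine hf ?_
    rw [← hw]
    exact Ideal.mul_mem_mul ((IsLocalRing.mem_maximalIdeal w).mpr hwu)
      (hmϖ ▸ Ideal.mem_span_singleton_self ϖ)
  have hmf : m = Ideal.span {algebraMap S R f} := by
    rw [hmϖ, ← hw, Ideal.span_singleton_mul_left_unit hwu]
  refine ⟨f, hfG, exists_notMem_forall_mul_mem _ (IsNoetherian.noetherian P) fun p hp => ?_⟩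
  have : algebraMap S R p ∈ Ideal.map (algebraMap S R) (Ideal.span {f}) := by
    rw [Ideal.map_span, Set.image_singleton, ← hmf, ← hmap]
    exact Ideal.mem_map_of_mem _ hp
  exact (IsLocalization.algebraMap_mem_map_algebraMap_iff P.primeCompl R _ _).mp this

end Domain

end GrMod

/-! ### Vanishing of Ext out of free modules of rank one and of hypersurface quotients. -/

namespace GrMod

variable {k : Type v} {S : Type u} [Field k] [CommRing S] [Algebra k S] {𝒜 : ℤ → Submodule k S}
  [IsNoetherianRing S]

section

variable {C : Type*} [Category C] [Abelian C] [HasExt.{w} C]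

theorem ext_eq_zero_of_isZero_right {X Y : C} (h : IsZero Y) {n : ℕ} (α : Ext X Y n) : α = 0 := by
  rw [← Ext.comp_mk₀_id α, h.eq_zero_of_src (𝟙 Y), Ext.mk₀_zero, Ext.comp_zero]

theorem ext_eq_zero_of_isZero_left {X Y : C} (h : IsZero X) {n : ℕ} (α : Ext X Y n) : α = 0 := by
  rw [← Ext.mk₀_id_comp α, h.eq_zero_of_src (𝟙 X), Ext.mk₀_zero, Ext.zero_comp]

end

omit [IsNoetherianRing S] in
theorem isArtinian_of_subsingleton (X : GrMod 𝒜) (h : Subsingleton X.carrier) :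
    IsArtinian S X.carrier := inferInstance

omit [IsNoetherianRing S] in
theorem isArtinian_of_isMaximal_torsionOf {X : GrMod 𝒜} {x : X.carrier}
    (hx : Submodule.span S {x} = ⊤) (h : (Ideal.torsionOf S X.carrier x).IsMaximal) :
    IsArtinian S X.carrier := by
  have : IsSimpleModule S (S ⧸ Ideal.torsionOf S X.carrier x) :=
    isSimpleModule_iff_isCoatom.mpr h.out
  refine isArtinian_of_surjective (S ⧸ Ideal.torsionOf S X.carrier x)
    (Submodule.liftQ _ (LinearMap.toSpanSingleton S _ x)
      (show _ ≤ LinearMap.ker _ from fun _ h => h)) ?_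
  rw [← LinearMap.range_eq_top, Submodule.range_liftQ, LinearMap.range_toSpanSingleton, hx]

section Cyclic

variable {X : GrMod 𝒜} {x : X.carrier} (hx : Submodule.span S {x} = ⊤)

include hx

omit [IsNoetherianRing S] in
theorem smul_eq_zero_of_mem_torsionOf {a : S} (ha : a ∈ Ideal.torsionOf S X.carrier x)
    (y : X.carrier) : a • y = 0 := by
  obtain ⟨b, rfl⟩ := Submodule.mem_span_singleton.mp (hx ▸ Submodule.mem_top : y ∈ _)
  rw [smul_comm, (Ideal.mem_torsionOf_iff x a).mp ha, smul_zero]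

omit [IsNoetherianRing S] in
theorem smul_injective_of_notMem_torsionOf [h : (Ideal.torsionOf S X.carrier x).IsPrime] {a : S}
    (ha : a ∉ Ideal.torsionOf S X.carrier x) (y : X.carrier) (hy : a • y = 0) : y = 0 := by
  obtain ⟨b, rfl⟩ := Submodule.mem_span_singleton.mp (hx ▸ Submodule.mem_top : y ∈ _)
  rw [← mul_smul] at hy
  exact (h.mem_or_mem ((Ideal.mem_torsionOf_iff x (a * b)).mpr hy)).resolve_left ha

/-- Multiplication by a homogeneous element outside of the annihilator of a cyclic module of
dimension one is an isomorphism in `QGr`. -/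
theorem isIso_toQGr_map_of_eq_smul [IsDomain S] (hdim : ringKrullDim S = 2)
    [h : (Ideal.torsionOf S X.carrier x).IsPrime] (h0 : Ideal.torsionOf S X.carrier x ≠ ⊥) {a : S}
    (ha : a ∉ Ideal.torsionOf S X.carrier x) {Y : GrMod 𝒜} (e : X.carrier ≃ₗ[S] Y.carrier)
    (f : X ⟶ Y) (hf : ∀ y, f.lin y = a • e y) : IsIso ((toQGr 𝒜).map f) := by
  refine isIso_toQGr_map_of_injective f ?_ ?_
  · rw [injective_iff_map_eq_zero]
    intro y hy
    rw [hf, ← map_smul, e.map_eq_zero_iff] at hy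
    exact smul_injective_of_notMem_torsionOf hx ha y hy
  · refine isArtinian_of_span_singleton hdim h0 ha (x := (LinearMap.range f.lin).mkQ (e x))
      ?_ ?_ ?_
    · rw [← Set.image_singleton, ← Submodule.map_span, ← Set.image_singleton,
        ← LinearEquiv.coe_coe, ← Submodule.map_span, hx, Submodule.map_top, LinearEquiv.range,
        Submodule.map_top, Submodule.range_mkQ]
    · intro p hp
      rw [← map_smul, ← map_smul, (Ideal.mem_torsionOf_iff x p).mp hp, map_zero, map_zero]
    · rw [← map_smul, Submodule.mkQ_apply, Submodule.Quotient.mk_eq_zero]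
      exact ⟨x, hf x⟩

end Cyclic

variable [GradedAlgebra 𝒜] [IsDomain S] (hdim : ringKrullDim S = 2) [HasExt.{w} (QGr 𝒜)]

include hdim

/-- Higher extensions of free modules of rank one by torsion modules vanish. -/
theorem ext_selfShift_eq_zero_of_torsion {f : S} (hf : f ≠ 0) (X : GrMod 𝒜)
    (hX : ∀ x : X.carrier, f • x = 0) {m : ℤ} {n : ℕ}
    (α : Ext ((toQGr 𝒜).obj (selfShift 𝒜 m)) ((toQGr 𝒜).obj X) (n + 1)) : α = 0 := by
  revert m n α
  refine induction_of_cyclic f (fun X => ∀ {m : ℤ} {n : ℕ}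
    (α : Ext ((toQGr 𝒜).obj (selfShift 𝒜 m)) ((toQGr 𝒜).obj X) (n + 1)), α = 0) ?_ ?_ ?_ X hX
  · intro X hX m n α
    exact ext_eq_zero_of_isZero_right (isZero_toQGr_obj (isArtinian_of_subsingleton X hX)) α
  · intro T hT h₁ h₃ m n α
    obtain ⟨β, rfl⟩ := covariant_exact₂ hT α (h₃ _)
    rw [h₁ β, Ext.zero_comp]
  · intro X j x hxj hx hprime hfx m n α
    by_cases hmax : (Ideal.torsionOf S X.carrier x).IsMaximal
    · exact ext_eq_zero_of_isZero_right
        (isZero_toQGr_obj (isArtinian_of_isMaximal_torsionOf hx hmax)) α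
    have h0 : Ideal.torsionOf S X.carrier x ≠ ⊥ := fun h => hf (by
      rw [← Ideal.mem_bot, ← h]
      exact hfx)
    -- The element `a` kills `α`, yet acts invertibly on `X` in `QGr`.
    obtain ⟨d, a, ha, haP, h⟩ := exists_comp_mul_eq_zero _ hmax α
    have := isIso_toQGr_map_of_eq_smul hx hdim h0 haP (Y := X.shift d) (LinearEquiv.refl S _)
      (X.mul ha) (fun _ => rfl)
    apply comp_mk₀_injective ((toQGr 𝒜).map (X.mul ha))
    rw [h, Ext.zero_comp]

/-- Extensions of degree at least two of free modules of rank one vanish. -/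
theorem ext_selfShift_eq_zero (X : GrMod 𝒜) {m : ℤ} {n : ℕ}
    (α : Ext ((toQGr 𝒜).obj (selfShift 𝒜 m)) ((toQGr 𝒜).obj X) (n + 2)) : α = 0 := by
  revert m n α
  refine induction_of_cyclic 0 (fun X => ∀ {m : ℤ} {n : ℕ}
    (α : Ext ((toQGr 𝒜).obj (selfShift 𝒜 m)) ((toQGr 𝒜).obj X) (n + 2)), α = 0) ?_ ?_ ?_ X
    (fun x => zero_smul S x)
  · intro X hX m n α
    exact ext_eq_zero_of_isZero_right (isZero_toQGr_obj (isArtinian_of_subsingleton X hX)) α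
  · intro T hT h₁ h₃ m n α
    obtain ⟨β, rfl⟩ := covariant_exact₂ hT α (h₃ _)
    rw [h₁ β, Ext.zero_comp]
  · intro X j x hxj hx hprime _ m n α
    by_cases h0 : Ideal.torsionOf S X.carrier x = ⊥
    · obtain ⟨d, a, ha, haP, h⟩ := exists_comp_mul_eq_zero ⊥ (not_isMaximal_bot hdim) α
      rw [← h0] at haP
      have hinj : Function.Injective (X.mul ha).lin := by
        rw [injective_iff_map_eq_zero]
        exact smul_injective_of_notMem_torsionOf hx haP
      -- As `a` kills `α`, it comes from a class one degree lower with values in the torsion module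
      -- `X / aX`; that degree is still positive.
      obtain ⟨β, rfl⟩ := covariant_exact₁ (shortExact_coker _ hinj) rfl α h
      have ha0 : a ≠ 0 := fun h => haP (h ▸ zero_mem _)
      rw [ext_selfShift_eq_zero_of_torsion hdim ha0 _ ?_ β, Ext.zero_comp]
      intro y
      obtain ⟨y, rfl⟩ := cokerπ_surjective _ y
      rw [← map_smul, cokerπ_eq_zero_iff]
      exact ⟨y, rfl⟩
    · obtain ⟨f, hfP, hf⟩ := Submodule.exists_mem_ne_zero_of_ne_bot h0
      exact ext_selfShift_eq_zero_of_torsion hdim hf X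
        (fun y => smul_eq_zero_of_mem_torsionOf hx hfP y) α

/-- A homogeneous element acts surjectively on the first extension groups of free modules of
rank one. -/
theorem exists_comp_mul_eq {d : ℤ} {f : S} (hfd : f ∈ 𝒜 d) (hf : f ≠ 0) (X : GrMod 𝒜) {m : ℤ}
    (α : Ext ((toQGr 𝒜).obj (selfShift 𝒜 m)) ((toQGr 𝒜).obj (X.shift d)) 1) :
    ∃ β : Ext ((toQGr 𝒜).obj (selfShift 𝒜 m)) ((toQGr 𝒜).obj X) 1,
      β.comp (Ext.mk₀ ((toQGr 𝒜).map (X.mul hfd))) (add_zero 1) = α := by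
  -- Factor multiplication by `f` through its image. Lifting to the image is obstructed by Ext¹ into
  -- the `f`-torsion cokernel, lifting on to `X` by Ext² into the kernel; both vanish.
  obtain ⟨γ, hγ⟩ := covariant_exact₂ (shortExact_coker _ (rangeι_injective (X.mul hfd))) α
    (ext_selfShift_eq_zero_of_torsion hdim hf _ (by
      intro y
      obtain ⟨y, rfl⟩ := cokerπ_surjective _ y
      rw [← map_smul, cokerπ_eq_zero_iff, range_rangeι]
      exact ⟨y, rfl⟩) _)
  obtain ⟨β, hβ⟩ := covariant_exact₃ (shortExact_ker _ (toRange_surjective (X.mul hfd))) rfl γ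
    (ext_selfShift_eq_zero hdim _ _)
  refine ⟨β, ?_⟩
  rw [← hγ, ← hβ, Ext.comp_assoc_of_third_deg_zero, Ext.mk₀_comp_mk₀, ← Functor.map_comp,
    toRange_comp_rangeι]

/-- As Ext² vanishes on free modules of rank one, a class here is the boundary of a class `β` of
degree one. Surjectivity of `f` acting on the target, turned into an action on the source by shift
transport, makes `β` a restriction along `f`, and then its boundary is zero. -/
theorem ext_two_coker_mul_eq_zero {d : ℤ} {f : S} (hfd : f ∈ 𝒜 d) (hf : f ≠ 0) {m : ℤ}
    {Y : GrMod 𝒜}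
    (α : Ext ((toQGr 𝒜).obj (coker ((selfShift 𝒜 m).mul hfd))) ((toQGr 𝒜).obj Y) 2) : α = 0 := by
  have hinj : Function.Injective ((selfShift 𝒜 m).mul hfd).lin := fun a b h =>
    mul_left_cancel₀ (M₀ := S) hf h
  have hse := shortExact_coker _ hinj
  have hα : (Ext.mk₀ ((toQGr 𝒜).map (cokerπ ((selfShift 𝒜 m).mul hfd)))).comp α
      (zero_add 2) = 0 := by
    apply mk₀_comp_injective ((toQGr 𝒜).map ((self 𝒜).shiftShift (a := m) (b := d) rfl).inv)
    exact (ext_selfShift_eq_zero hdim _ _).trans (Ext.comp_zero _ _ _ _ _).symm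
  obtain ⟨β, rfl⟩ := contravariant_exact₃ hse rfl α hα
  let θ : (Y.shift (-d)).shift d ≅ Y := Y.shiftShift (neg_add_cancel d) ≪≫ Y.shiftZero
  obtain ⟨γ, hγ⟩ := exists_comp_mul_eq hdim hfd hf (Y.shift (-d))
    (β.comp (Ext.mk₀ ((toQGr 𝒜).map θ.inv)) (add_zero 1))
  obtain ⟨γ', hγ'⟩ := exists_shift_ext hfd γ
  have hβ : β = (Ext.mk₀ ((toQGr 𝒜).map ((selfShift 𝒜 m).mul hfd))).comp
      (γ'.comp (Ext.mk₀ ((toQGr 𝒜).map θ.hom)) (add_zero 1)) (zero_add 1) := by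
    rw [← Ext.comp_assoc_of_third_deg_zero, hγ', hγ, Ext.comp_assoc_of_third_deg_zero,
      Ext.mk₀_comp_mk₀, ← Functor.map_comp, Iso.inv_hom_id,
      CategoryTheory.Functor.map_id, Ext.comp_mk₀_id]
  rw [hβ]
  exact extClass_comp_map_comp hse rfl _

end GrMod

/-! ### Cyclic modules at regular homogeneous primes; vanishing of Ext². -/

namespace GrMod

variable {k : Type v} {S : Type u} [Field k] [CommRing S] [Algebra k S] {𝒜 : ℤ → Submodule k S}
  [GradedAlgebra 𝒜]

theorem isHomogeneous_torsionOf {X : GrMod 𝒜} {j : ℤ} {x : X.carrier} (hx : x ∈ X.piece j) :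
    (Ideal.torsionOf S X.carrier x).IsHomogeneous 𝒜 := by
  intro i s hs
  have h := X.proj_smul_of_mem rfl hx (i := i) s
  rw [(Ideal.mem_torsionOf_iff x s).mp hs, map_zero] at h
  exact (Ideal.mem_torsionOf_iff _ _).mpr h.symm

theorem span_homogeneous_eq {P : Ideal S} (hP : P.IsHomogeneous 𝒜) :
    Ideal.span {f | f ∈ P ∧ SetLike.IsHomogeneousElem 𝒜 f} = P := by
  classical
  apply le_antisymm
  · rw [Ideal.span_le]
    exact fun f hf => hf.1
  · intro x hx
    rw [← DirectSum.sum_support_decompose 𝒜 x]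
    exact sum_mem fun i _ => Ideal.subset_span ⟨hP i hx, i, SetLike.coe_mem _⟩

/-- Homogeneous elements generate `P`, so one of them is a uniformizer `f`. The denominator may be
replaced by a homogeneous component outside `P`, because `(f)` is homogeneous and can be tested on
homogeneous `p`. -/
theorem exists_homogeneous_uniformizer [IsDomain S] [IsNoetherianRing S]
    (hdim : ringKrullDim S = 2) {P : Ideal S}
    [P.IsPrime] (hP : P.IsHomogeneous 𝒜) (h0 : P ≠ ⊥) (hmax : ¬ P.IsMaximal)
    [IsRegularLocalRing (Localization.AtPrime P)] :
    ∃ (d : ℤ) (f : S) (_ : f ∈ 𝒜 d) (e : ℤ) (s : S) (_ : s ∈ 𝒜 e), f ∈ P ∧ s ∉ P ∧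
      ∀ p ∈ P, s * p ∈ Ideal.span {f} := by
  classical
  obtain ⟨f, ⟨hfP, d, hfd⟩, t, ht, h⟩ :=
    exists_forall_mul_mem_span_singleton hdim h0 hmax (span_homogeneous_eq hP)
  obtain ⟨e, he⟩ : ∃ e, (DirectSum.decompose 𝒜 t e : S) ∉ P := by
    by_contra! hne
    apply ht
    rw [← DirectSum.sum_support_decompose 𝒜 t]
    exact sum_mem fun i _ => hne i
  refine ⟨d, f, hfd, e, _, SetLike.coe_mem _, hfP, he, ?_⟩
  have hhom : (Ideal.span {f}).IsHomogeneous 𝒜 := Ideal.homogeneous_span 𝒜 _ (by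
    rintro _ rfl
    exact ⟨d, hfd⟩)
  have hle : P ≤ Submodule.comap
      (LinearMap.mulLeft S (DirectSum.decompose 𝒜 t e : S)) (Ideal.span {f}) := by
    conv_lhs => rw [← span_homogeneous_eq hP]
    rw [Ideal.span_le]
    rintro p ⟨hp, j, hpj⟩
    change (DirectSum.decompose 𝒜 t e : S) * p ∈ Ideal.span {f}
    rw [← DirectSum.coe_decompose_mul_add_of_right_mem 𝒜 hpj]
    exact hhom _ (h p hp)
  exact fun p hp => hle hp

variable [IsNoetherianRing S]

omit [GradedAlgebra 𝒜] in
/-- A morphism factors through a surjective morphism whose kernel it kills. -/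
theorem exists_desc {X Y Z : GrMod 𝒜} (p : Y ⟶ X) (hp : Function.Surjective p.lin) (g : Y ⟶ Z)
    (h : ∀ y, p.lin y = 0 → g.lin y = 0) : ∃ l : X ⟶ Z, ∀ y, l.lin (p.lin y) = g.lin y := by
  obtain ⟨l, hl⟩ := CokernelCofork.IsColimit.desc' (isColimitOfExact (kerι p) p (kerι_comp p) hp
    (mem_range_kerι p)) g (by
      ext y
      exact h _ y.2)
  exact ⟨l, fun y => congrArg (fun f : Y ⟶ Z => f.lin y) hl⟩

variable [IsDomain S] (hdim : ringKrullDim S = 2) [HasExt.{w} (QGr 𝒜)]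

include hdim

/-- With `P` the annihilator of `x`, and `f`, `s` as in `exists_homogeneous_uniformizer`,
multiplication by `s` on `S / P` factors through `S / f`, where Ext² vanishes, and it is an
isomorphism in `QGr`. -/
theorem ext_two_cyclic_eq_zero {X Y : GrMod 𝒜} {j : ℤ} {x : X.carrier} (hxj : x ∈ X.piece j)
    (hx : Submodule.span S {x} = ⊤) [hprime : (Ideal.torsionOf S X.carrier x).IsPrime]
    (h0 : Ideal.torsionOf S X.carrier x ≠ ⊥) (hmax : ¬ (Ideal.torsionOf S X.carrier x).IsMaximal)
    [IsRegularLocalRing (Localization.AtPrime (Ideal.torsionOf S X.carrier x))]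
    (α : Ext ((toQGr 𝒜).obj X) ((toQGr 𝒜).obj Y) 2) : α = 0 := by
  obtain ⟨d, f, hfd, e, s, hse, hfP, hsP, hs⟩ :=
    exists_homogeneous_uniformizer hdim (isHomogeneous_torsionOf hxj) h0 hmax
  have hf : f ≠ 0 := by
    rintro rfl
    apply h0
    rw [eq_bot_iff]
    intro p hp
    have h1 := hs p hp
    rw [Ideal.span_singleton_eq_bot.mpr rfl, Ideal.mem_bot] at h1
    exact (mul_eq_zero.mp h1).resolve_left fun h => hsP (h ▸ zero_mem _)
  -- The twist makes the target `M.shift d` of multiplication by `f` isomorphic to `S(-j)`, whose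
  -- generator has the degree `j` of `x`.
  let M := selfShift 𝒜 (-j - d)
  let p : M.shift d ⟶ X := ((self 𝒜).shiftShift (sub_add_cancel (-j) d)).hom ≫
    ofElem X (neg_neg j).symm hxj
  have hp : ∀ b : S, p.lin b = b • x := fun b => rfl
  have hsurj : Function.Surjective p.lin := by
    intro y
    obtain ⟨b, rfl⟩ := Submodule.mem_span_singleton.mp (hx ▸ Submodule.mem_top : y ∈ _)
    exact ⟨b, rfl⟩
  obtain ⟨π, hπ⟩ := exists_desc (cokerπ (M.mul hfd)) (cokerπ_surjective _) p (by
    intro y hy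
    obtain ⟨b, rfl⟩ := (cokerπ_eq_zero_iff _ _).mp hy
    change (f * (show S from b)) • x = 0
    rw [mul_comm, mul_smul, (Ideal.mem_torsionOf_iff x f).mp hfP, smul_zero])
  let g : (M.shift d).shift (-e) ⟶ coker (M.mul hfd) :=
    GrMod.mul _ hse ≫ ((M.shift d).shiftShift (neg_add_cancel e)).hom ≫ (M.shift d).shiftZero.hom ≫
      cokerπ (M.mul hfd)
  have hg : ∀ b : S, g.lin b = (cokerπ (M.mul hfd)).lin (s * b : S) := fun b => rfl
  obtain ⟨σ, hσ⟩ := exists_desc (shiftMap p (-e)) hsurj g (by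
    intro b hb
    obtain ⟨c, hc⟩ := Ideal.mem_span_singleton'.mp (hs b ((Ideal.mem_torsionOf_iff x _).mpr hb))
    refine (hg b).trans ((cokerπ_eq_zero_iff _ _).mpr ⟨c, ?_⟩)
    exact (mul_comm f c).trans hc)
  have hcomp : ∀ y : X.carrier, (σ ≫ π).lin y = s • y := by
    intro y
    obtain ⟨b, rfl⟩ := hsurj y
    have h1 : σ.lin (p.lin b) = g.lin b := hσ b
    change π.lin (σ.lin (p.lin b)) = s • p.lin b
    exact (congrArg π.lin (h1.trans (hg b))).trans ((hπ _).trans (map_smul p.lin s b))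
  have := isIso_toQGr_map_of_eq_smul (X := X.shift (-e)) hx hdim (h := hprime) h0 hsP (Y := X)
    (LinearEquiv.refl S _) (σ ≫ π) hcomp
  apply mk₀_comp_injective ((toQGr 𝒜).map (σ ≫ π))
  rw [Functor.map_comp, ← Ext.mk₀_comp_mk₀_assoc, ext_two_coker_mul_eq_zero hdim hfd hf
    ((Ext.mk₀ ((toQGr 𝒜).map π)).comp α (zero_add 2)), Ext.comp_zero, Ext.comp_zero]

/-- Dévissage leaves cyclic modules with prime annihilator: a maximal one gives zero in `QGr`, the
zero ideal a shifted free module, and any other prime is covered by regularity of its localization.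
-/
theorem ext_two_eq_zero (hreg : IsIsolatedSingularity S) (X Y : GrMod 𝒜)
    (α : Ext ((toQGr 𝒜).obj X) ((toQGr 𝒜).obj Y) 2) : α = 0 := by
  revert α
  refine induction_of_cyclic 0 (fun X => ∀ α : Ext ((toQGr 𝒜).obj X) ((toQGr 𝒜).obj Y) 2, α = 0)
    ?_ ?_ ?_ X (fun x => zero_smul S x)
  · intro X hX α
    exact ext_eq_zero_of_isZero_left (isZero_toQGr_obj (isArtinian_of_subsingleton X hX)) α
  · intro T hT h₁ h₃ α
    obtain ⟨β, rfl⟩ := contravariant_exact₂ hT α (h₁ _)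
    rw [h₃ β, Ext.comp_zero]
  · intro X j x hxj hx hprime _ α
    by_cases hmax : (Ideal.torsionOf S X.carrier x).IsMaximal
    · exact ext_eq_zero_of_isZero_left
        (isZero_toQGr_obj (isArtinian_of_isMaximal_torsionOf hx hmax)) α
    by_cases h0 : Ideal.torsionOf S X.carrier x = ⊥
    · let p : selfShift 𝒜 (-j) ⟶ X := ofElem X (neg_neg j).symm hxj
      have hinj : Function.Injective p.lin := by
        rw [injective_iff_map_eq_zero]
        intro b hb
        have : b ∈ Ideal.torsionOf S X.carrier x := hb
        rwa [h0] at this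
      have hsurj : Function.Surjective p.lin := by
        intro y
        obtain ⟨b, rfl⟩ := Submodule.mem_span_singleton.mp (hx ▸ Submodule.mem_top : y ∈ _)
        exact ⟨b, rfl⟩
      have := isIso_toQGr_map_of_injective p hinj (by
        rw [LinearMap.range_eq_top.mpr hsurj]
        infer_instance)
      apply mk₀_comp_injective ((toQGr 𝒜).map p)
      rw [ext_selfShift_eq_zero hdim Y ((Ext.mk₀ ((toQGr 𝒜).map p)).comp α (zero_add 2)),
        Ext.comp_zero]
    · have := hreg.2 _ hmax
      exact ext_two_cyclic_eq_zero hdim hxj hx h0 hmax α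

end GrMod

theorem isHereditary_of_isIsolatedSingularity {k : Type v} {S : Type u} [Field k] [CommRing S]
    [IsDomain S] [Algebra k S] [IsNoetherianRing S] (𝒜 : ℤ → Submodule k S) [GradedAlgebra 𝒜]
    (hdim : ringKrullDim S = 2) (hreg : IsIsolatedSingularity S) : IsHereditary (QGr 𝒜) := by
  let := HasExt.standard (QGr 𝒜)
  intro X Y i hi
  refine subsingleton_of_forall_eq 0 fun α => Ext.eq_zero_of_two_le (fun X Y α => ?_) hi α
  have := Localization.essSurj (GrMod.toQGr 𝒜) (GrMod.finiteLength 𝒜).isoModSerre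
  apply GrMod.mk₀_comp_injective ((GrMod.toQGr 𝒜).objObjPreimageIso X).hom
  apply GrMod.comp_mk₀_injective ((GrMod.toQGr 𝒜).objObjPreimageIso Y).inv
  rw [GrMod.ext_two_eq_zero hdim hreg _ _ (Ext.comp _ _ _), Ext.comp_zero, Ext.zero_comp]

/-! ### Primes without nonzero homogeneous elements. -/

namespace GrMod

variable {k : Type v} {S : Type u} [Field k] [CommRing S] [Algebra k S] {𝒜 : ℤ → Submodule k S}

section Width

variable [GradedAlgebra 𝒜]

variable (𝒜) in
/-- The property of having nonzero components in at most `n` consecutive degrees. -/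
def HasWidth (f : S) (n : ℕ) : Prop :=
  ∃ a : ℤ, ∀ i, i < a ∨ a + n ≤ i → (DirectSum.decompose 𝒜 f i : S) = 0

theorem exists_hasWidth (f : S) : ∃ n, HasWidth 𝒜 f n := by
  classical
  obtain ⟨b, hb⟩ := (DirectSum.decompose 𝒜 f).support.bddAbove
  obtain ⟨a, ha⟩ := (DirectSum.decompose 𝒜 f).support.bddBelow
  refine ⟨(b + 1 - a).toNat, a, fun i hi => ?_⟩
  by_contra hne
  have hmem : i ∈ (DirectSum.decompose 𝒜 f).support :=
    DFinsupp.mem_support_iff.mpr fun h => hne (by rw [h]; rfl)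
  have h1 := hb hmem
  have h2 := ha hmem
  omega

theorem eq_zero_of_hasWidth_zero {f : S} (h : HasWidth 𝒜 f 0) : f = 0 := by
  classical
  obtain ⟨a, ha⟩ := h
  rw [← DirectSum.sum_support_decompose 𝒜 f]
  exact Finset.sum_eq_zero fun i _ => ha i (by rw [Nat.cast_zero, add_zero]; exact lt_or_ge i a)

theorem decompose_mul_of_left_mem {i : ℤ} {x : S} (hx : x ∈ 𝒜 i) (y : S) (l : ℤ) :
    (DirectSum.decompose 𝒜 (x * y) l : S) = x * DirectSum.decompose 𝒜 y (l - i) := by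
  rw [← DirectSum.coe_decompose_mul_add_of_left_mem 𝒜 hx, add_sub_cancel]

/-- Division with remainder by an element of minimal width in an ideal without nonzero homogeneous
elements. -/
theorem exists_forall_mul_mem_of_inhomogeneous [IsDomain S] {P : Ideal S} [P.IsPrime]
    (hP : ∀ i, ∀ x ∈ 𝒜 i, x ∈ P → x = 0) :
    ∃ y ∈ P, ∀ p ∈ P, ∃ t ∉ P, t * p ∈ Ideal.span {y} := by
  classical
  have hP1 : (1 : S) ∉ P := (Ideal.ne_top_iff_one P).mp (Ideal.IsPrime.ne_top inferInstance)
  by_cases h0 : P = ⊥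
  · refine ⟨0, zero_mem _, fun p hp => ⟨1, hP1, ?_⟩⟩
    rw [h0, Ideal.mem_bot] at hp
    rw [hp, mul_zero]
    exact zero_mem _
  have hex : ∃ n, ∃ f ∈ P, f ≠ 0 ∧ HasWidth 𝒜 f n := by
    obtain ⟨f, hf, hf0⟩ := Submodule.exists_mem_ne_zero_of_ne_bot h0
    obtain ⟨n, hn⟩ := exists_hasWidth (𝒜 := 𝒜) f
    exact ⟨n, f, hf, hf0, hn⟩
  obtain ⟨n, ⟨f, hf, hf0, hn⟩, hmin⟩ : ∃ n, (∃ f ∈ P, f ≠ 0 ∧ HasWidth 𝒜 f n) ∧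
      ∀ m < n, ∀ g ∈ P, HasWidth 𝒜 g m → g = 0 :=
    ⟨Nat.find hex, Nat.find_spec hex, fun m hm g hg hw => by
      by_contra hg0
      exact Nat.find_min hex hm ⟨g, hg, hg0, hw⟩⟩
  obtain ⟨n, rfl⟩ : ∃ m, n = m + 1 := Nat.exists_eq_succ_of_ne_zero fun h =>
    hf0 (eq_zero_of_hasWidth_zero (h ▸ hn))
  obtain ⟨a, ha⟩ := hn
  -- A top component in `P` would vanish, and `f` would have smaller width.
  have htop : (DirectSum.decompose 𝒜 f (a + n) : S) ∉ P := by
    intro hmem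
    have hz := hP _ _ (SetLike.coe_mem _) hmem
    refine hf0 (hmin n n.lt_succ_self f hf ⟨a, fun i hi => ?_⟩)
    by_cases hi' : i = a + n
    · rw [hi', hz]
    · exact ha i (by push_cast; omega)
  refine ⟨f, hf, fun g hg => ?_⟩
  obtain ⟨m, hm⟩ := exists_hasWidth (𝒜 := 𝒜) g
  induction m generalizing g with
  | zero =>
    refine ⟨1, hP1, ?_⟩
    rw [eq_zero_of_hasWidth_zero hm, mul_zero]
    exact zero_mem _
  | succ m ih =>
    by_cases hlt : m < n
    · refine ⟨1, hP1, ?_⟩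
      rw [hmin (m + 1) (by omega) g hg hm, mul_zero]
      exact zero_mem _
    obtain ⟨c, hc⟩ := hm
    let x : S := DirectSum.decompose 𝒜 f (a + n)
    let y : S := DirectSum.decompose 𝒜 g (c + m)
    have hx : x ∈ 𝒜 (a + n) := SetLike.coe_mem _
    have hy : y ∈ 𝒜 (c + m) := SetLike.coe_mem _
    -- Cross-multiplying by the top components cancels the top degree. Since `n ≤ m`, the term `y *
    -- f` adds no degrees below those of `x * g`, so the width drops to `m`.
    obtain ⟨t, ht, hmem⟩ := ih (x * g - y * f) (sub_mem (P.mul_mem_left _ hg) (P.mul_mem_left _ hf))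
      ⟨a + n + c, fun i hi => by
        rw [DirectSum.decompose_sub, DirectSum.sub_apply, AddSubgroupClass.coe_sub,
          decompose_mul_of_left_mem hx, decompose_mul_of_left_mem hy]
        by_cases hi' : i = a + n + c + m
        · rw [show i - (a + n) = c + m by omega, show i - (c + m) = a + n by omega]
          exact sub_eq_zero.mpr (mul_comm _ _)
        · rw [hc (i - (a + n)) (by push_cast; omega), ha (i - (c + m)) (by push_cast; omega),
            mul_zero, mul_zero, sub_zero]⟩
    refine ⟨t * x, fun h => (Ideal.IsPrime.mem_or_mem inferInstance h).elim ht htop, ?_⟩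
    have := add_mem hmem ((Ideal.span {f}).mul_mem_left (t * y) (Ideal.mem_span_singleton_self f))
    convert this using 1
    ring

end Width

/-! ### A regularity criterion from a splitting up to denominators. -/

section Algebra

variable [IsDomain S] [IsNoetherianRing S]

/-- A prime ideal which is locally a direct summand of a free module in a suitable sense has a
regular local ring. -/
theorem isRegularLocalRing_of_sum_mul_eq {P : Ideal S} [P.IsPrime] (hP : P ≠ ⊥) {ι : Type*}
    [Fintype ι] (f : ι → S) (hf : ∀ i, f i ∈ P) (ψ : ι → P →ₗ[S] S) {b : S} (hb : b ∉ P)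
    (h : ∀ x : P, ∑ i, ψ i x * f i = b * x) : IsRegularLocalRing (Localization.AtPrime P) := by
  by_cases hψ : ∀ i x, ψ i x ∈ P
  · exfalso
    let R := Localization.AtPrime P
    let m := IsLocalRing.maximalIdeal R
    have hmap : P.map (algebraMap S R) = m := Localization.AtPrime.map_eq_maximalIdeal
    -- If all `ψ i` take values in `P`, then `b * x ∈ P * P` for `x ∈ P`, and `b` is a unit in the
    -- localization.
    have hle : m ≤ m * m := by
      rw [← hmap, ← Ideal.map_mul, Ideal.map_le_iff_le_comap]
      intro x hx
      refine (IsLocalization.algebraMap_mem_map_algebraMap_iff P.primeCompl R _ _).mpr ⟨b, hb, ?_⟩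
      rw [← h ⟨x, hx⟩]
      exact sum_mem fun i _ => Ideal.mul_mem_mul (hψ i _) (hf i)
    have hm0 := Submodule.eq_bot_of_le_smul_of_le_jacobson_bot m m (IsNoetherian.noetherian m) hle
      (IsLocalRing.maximalIdeal_le_jacobson ⊥)
    rw [← hmap, Ideal.map_eq_bot_iff_of_injective
      (IsLocalization.injective R P.primeCompl_le_nonZeroDivisors)] at hm0
    exact hP hm0
  · push Not at hψ
    obtain ⟨i, y, hy⟩ := hψ
    refine isRegularLocalRing_of_forall_mul_mem y.1 y.2 fun p hp => ⟨ψ i y, hy, ?_⟩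
    -- Linearity of `ψ i` turns this symmetry into `p * ψ i y = y * ψ i p`.
    have h1 : (p • y : P) = y.1 • ⟨p, hp⟩ := Subtype.ext (mul_comm _ _)
    have h2 := congrArg (ψ i) h1
    rw [map_smul, map_smul, smul_eq_mul, smul_eq_mul] at h2
    rw [mul_comm, h2]
    exact Ideal.mul_mem_right _ _ (Ideal.mem_span_singleton_self _)

end Algebra

/-! ### Finite direct sums of graded modules. -/

section Pi

/-- The finite direct sum of graded modules. -/
def pi {ι : Type u} [Fintype ι] (X : ι → GrMod 𝒜) : GrMod 𝒜 where
  carrier := ∀ i, (X i).carrier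
  piece j := AddSubgroup.pi Set.univ fun i => (X i).piece j
  isInternal := isInternal_of_proj _
    (fun j => AddMonoidHom.pi fun i => ((X i).proj j).comp (Pi.evalAddMonoidHom _ i))
    (fun j x i _ => (X i).proj_mem j _)
    (fun j x hx => funext fun i => (X i).proj_of_mem j _ (hx i trivial))
    (fun j l hjl x hx => funext fun i => (X i).proj_of_ne j l hjl _ (hx i trivial))
    (fun x => by
      classical
      choose s hs using fun i => (X i).sum_proj (x i)
      refine ⟨Finset.univ.biUnion s, funext fun i => ?_⟩
      rw [Finset.sum_apply]
      exact hs i _ (Finset.subset_biUnion_of_mem s (Finset.mem_univ i)))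
  smul_mem ha hx i _ := (X i).smul_mem ha (hx i trivial)

/-- The morphism from a finite direct sum given by a family of morphisms. -/
def piDesc {ι : Type u} [Fintype ι] {X : ι → GrMod 𝒜} {Y : GrMod 𝒜} (g : ∀ i, X i ⟶ Y) :
    pi X ⟶ Y where
  lin := ∑ i, (g i).lin.comp (LinearMap.proj i)
  map_mem {j x} hx := by
    rw [LinearMap.sum_apply]
    exact sum_mem fun i _ => (g i).map_mem (hx i trivial)

theorem piDesc_lin {ι : Type u} [Fintype ι] {X : ι → GrMod 𝒜} {Y : GrMod 𝒜} (g : ∀ i, X i ⟶ Y)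
    (x : ∀ i, (X i).carrier) : (piDesc g).lin x = ∑ i, (g i).lin (x i) :=
  LinearMap.sum_apply _ _ _

end Pi

/-! ### Homogeneous primes: splitting a free cover up to denominators. -/

section Noetherian

variable [IsNoetherianRing S]

omit [IsNoetherianRing S] in
theorem sub_lin {X Y : GrMod 𝒜} (f g : X ⟶ Y) : (f - g).lin = f.lin - g.lin := by
  rw [sub_eq_add_neg, sub_eq_add_neg, add_lin, neg_lin]

theorem isArtinian_range_of_toQGr_map_eq_zero {X Y : GrMod 𝒜} {f : X ⟶ Y}
    (h : (toQGr 𝒜).map f = 0) : IsArtinian S (LinearMap.range f.lin) := by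
  have := epi_of_surjective _ (toRange_surjective f)
  have := mono_of_injective _ (rangeι_injective f)
  rw [← toRange_comp_rangeι f, Functor.map_comp,
    ObjectProperty.SerreClassLocalization.map_comp_eq_zero_iff_of_epi_mono _ (finiteLength 𝒜)] at h
  exact (finiteLength_iff _).mp h

variable {P : Ideal S} [P.IsPrime] (hP : ¬ P.IsMaximal)

include hP

/-- The multiples of a morphism to a torsion-free module in `QGr` lift to linear maps. -/
theorem exists_linearMap_of_comp_eq {K F : GrMod 𝒜} {d : ℤ} {a : S} (ha : a ∈ 𝒜 d) (haP : a ∉ P)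
    (htf : ∀ (c : S) (x : K.carrier), c ≠ 0 → c • x = 0 → x = 0) (i : K ⟶ F)
    (h : (toQGr 𝒜).obj F ⟶ (toQGr 𝒜).obj (K.shift d))
    (hi : (toQGr 𝒜).map i ≫ h = (toQGr 𝒜).map (K.mul ha)) :
    ∃ b ∉ P, ∃ φ : F.carrier →ₗ[S] K.carrier, ∀ x, φ (i.lin x) = b • x := by
  obtain ⟨K', g, t, ht, hg⟩ := exists_leftFraction h
  have hker : IsArtinian S (LinearMap.ker t.lin) := (mono_toQGr_map_iff t).mp inferInstance
  have hcoker : IsArtinian S (K'.carrier ⧸ LinearMap.range t.lin) :=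
    (epi_toQGr_map_iff t).mp inferInstance
  have hzero : (toQGr 𝒜).map (i ≫ g - K.mul ha ≫ t) = 0 := by
    rw [Functor.map_sub, Functor.map_comp, Functor.map_comp, ← hi, ← hg, Category.assoc, sub_self]
  have hdiff := isArtinian_range_of_toQGr_map_eq_zero hzero
  obtain ⟨c, hc, hcx⟩ := exists_notMem_smul_eq_zero hP (M := LinearMap.ker t.lin)
  obtain ⟨c₁, hc₁, hcx₁⟩ := exists_notMem_smul_eq_zero hP (M := K'.carrier ⧸ LinearMap.range t.lin)
  obtain ⟨c₂, hc₂, hcx₂⟩ := exists_notMem_smul_eq_zero hP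
    (M := LinearMap.range (i ≫ g - K.mul ha ≫ t).lin)
  -- The finite-length kernel of `t` is killed by some `c ∉ P`, and `K` is torsion-free.
  have hinj : Function.Injective t.lin := by
    rw [injective_iff_map_eq_zero]
    intro x hx
    refine htf c x (fun h => hc (h ▸ zero_mem _)) ?_
    exact congrArg Subtype.val (hcx ⟨x, hx⟩)
  have hrange : ∀ v, ((c₂ * c₁) • g.lin) v ∈ LinearMap.range t.lin := by
    intro v
    have := hcx₁ (Submodule.Quotient.mk (g.lin v))
    rw [← Submodule.Quotient.mk_smul, Submodule.Quotient.mk_eq_zero] at this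
    rw [LinearMap.smul_apply, mul_smul]
    exact Submodule.smul_mem _ _ this
  let φ : F.carrier →ₗ[S] K.carrier := (LinearEquiv.ofInjective t.lin hinj).symm.toLinearMap.comp
    (((c₂ * c₁) • g.lin).codRestrict _ hrange)
  have hφ : ∀ v, t.lin (φ v) = (c₂ * c₁) • g.lin v := fun v =>
    congrArg Subtype.val ((LinearEquiv.ofInjective t.lin hinj).apply_symm_apply ⟨_, hrange v⟩)
  -- Here `c₁` pushes `g` into the range of `t`, and `c₂` kills the finite-length discrepancy
  -- between `i ≫ g` and `a` times `t`.
  refine ⟨c₂ * c₁ * a, fun h => (Ideal.IsPrime.mem_or_mem inferInstance h).elim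
    (fun h => (Ideal.IsPrime.mem_or_mem inferInstance h).elim hc₂ hc₁) haP, φ, fun x => hinj ?_⟩
  have h1 : c₂ • (g.lin (i.lin x) - t.lin ((K.mul ha).lin x)) = 0 := by
    have := congrArg Subtype.val (hcx₂ ⟨_, x, rfl⟩)
    rw [sub_lin] at this
    exact this
  rw [smul_sub, sub_eq_zero] at h1
  have h2 : (c₂ * c₁) • g.lin (i.lin x) = t.lin ((c₂ * c₁) • (K.mul ha).lin x) := by
    rw [mul_comm, mul_smul, h1, map_smul, mul_smul]
  exact (hφ _).trans (h2.trans (congrArg t.lin (mul_smul (c₂ * c₁) a x).symm))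

variable [GradedAlgebra 𝒜] [HasExt.{w} (QGr 𝒜)]

/-- If `Ext²` vanishes then the class of an extension of a submodule of a free module of rank one is
killed by some homogeneous element outside of a given non-maximal prime ideal. -/
theorem exists_comp_eq_mul (hext : ∀ (X Y : GrMod 𝒜)
      (α : Ext ((toQGr 𝒜).obj X) ((toQGr 𝒜).obj Y) 2), α = 0)
    {F X : GrMod 𝒜} {q : F ⟶ X} (hq : Function.Surjective q.lin) {m : ℤ} (ι : X ⟶ selfShift 𝒜 m)
    (hι : Function.Injective ι.lin) :
    ∃ (d : ℤ) (a : S) (ha : a ∈ 𝒜 d) (h : (toQGr 𝒜).obj F ⟶ (toQGr 𝒜).obj ((ker q).shift d)),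
      a ∉ P ∧ (toQGr 𝒜).map (kerι q) ≫ h = (toQGr 𝒜).map ((ker q).mul ha) := by
  have h1 := shortExact_ker q hq
  -- Vanishing of Ext² on the cokernel of `ι` extends the class from `X` to the free module, where
  -- annihilation applies.
  obtain ⟨ε, hε⟩ := contravariant_exact₁ (shortExact_coker ι hι) rfl (extClass h1) (hext _ _ _)
  obtain ⟨d, a, ha, haP, h⟩ := exists_comp_mul_eq_zero P hP ε
  -- The pushout of the extension along multiplication by `a` splits, so this multiplication extends
  -- to `F`.
  obtain ⟨β, hβ⟩ := contravariant_exact₁ h1 rfl (Ext.mk₀ ((toQGr 𝒜).map ((ker q).mul ha))) (by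
    rw [← hε, Ext.comp_assoc_of_third_deg_zero, h, Ext.comp_zero])
  obtain ⟨φ, rfl⟩ := (Ext.mk₀_bijective _ _).2 β
  refine ⟨d, a, ha, φ, haP, ?_⟩
  rw [Ext.mk₀_comp_mk₀] at hβ
  exact (Ext.mk₀_bijective _ _).1 hβ

variable [IsDomain S]

/-- A graded free cover of `P` by homogeneous generators splits after multiplication by some `b ∉
P`; the coordinates of this near-section feed `isRegularLocalRing_of_sum_mul_eq`. -/
theorem isRegularLocalRing_of_isHomogeneous (hext : ∀ (X Y : GrMod 𝒜)
      (α : Ext ((toQGr 𝒜).obj X) ((toQGr 𝒜).obj Y) 2), α = 0)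
    (hhom : P.IsHomogeneous 𝒜) (h0 : P ≠ ⊥) : IsRegularLocalRing (Localization.AtPrime P) := by
  obtain ⟨G, hG, hspan⟩ := (Submodule.fg_span_iff_fg_span_finset_subset _).mp
    (IsNoetherian.noetherian (Ideal.span {f | f ∈ P ∧ SetLike.IsHomogeneousElem 𝒜 f}))
  choose d hd using fun i : G => (hG i.2).2
  let M := selfShift 𝒜 0
  have hM : M.IsHomogeneous P := (isHomogeneous_selfShift_iff 0 P).mpr hhom
  have hpiece : ∀ i : G, (⟨i.1, (hG i.2).1⟩ : P) ∈ (M.sub P hM).piece (d i) := fun i => by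
    change i.1 ∈ 𝒜 (d i + 0)
    rw [add_zero]
    exact hd i
  let F : GrMod 𝒜 := pi fun i : G => selfShift 𝒜 (-d i)
  let q : F ⟶ M.sub P hM := piDesc fun i => ofElem _ (neg_neg _).symm (hpiece i)
  have hqv : ∀ v : G → S, P.subtype (q.lin v) = ∑ i, v i * i.1 := fun v =>
    (congrArg P.subtype (piDesc_lin (fun i => ofElem _ (neg_neg _).symm (hpiece i)) v)).trans
      (map_sum P.subtype _ _)
  have hq : Function.Surjective q.lin := by
    rintro ⟨(x : S), hx⟩
    have hx' : x ∈ Submodule.span S (Set.range fun i : G => i.1) := by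
      rw [show (Set.range fun i : G => i.1) = (G : Set S) from Subtype.range_coe, ← hspan]
      exact (span_homogeneous_eq hhom).ge hx
    obtain ⟨c, hc⟩ := (Submodule.mem_span_range_iff_exists_fun S).mp hx'
    exact ⟨c, Subtype.ext ((hqv c).trans hc)⟩
  obtain ⟨e, a, ha, h, haP, hcomp⟩ := exists_comp_eq_mul hP hext hq (M.subι P hM)
    fun _ _ h => Subtype.ext h
  have htf : ∀ (c : S) (x : (ker q).carrier), c ≠ 0 → c • x = 0 → x = 0 := by
    intro c x hc hx
    refine Subtype.ext (funext fun i => ?_)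
    have := congrFun (congrArg Subtype.val hx) i
    exact (mul_eq_zero.mp this).resolve_left hc
  obtain ⟨b, hb, φ, hφ⟩ := exists_linearMap_of_comp_eq hP ha haP htf (kerι q) h hcomp
  -- On the kernel of `q`, `φ` is multiplication by `b`; hence `ψ` vanishes there and descends to a
  -- map from `P` whose composite with `q` is `b`.
  let ψ : F.carrier →ₗ[S] F.carrier := b • LinearMap.id - (kerι q).lin.comp φ
  have hψ : LinearMap.ker q.lin ≤ LinearMap.ker ψ := fun v hv => by
    have h1 := (congrArg (kerι q).lin (hφ ⟨v, hv⟩)).trans (map_smul (kerι q).lin b ⟨v, hv⟩)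
    exact sub_eq_zero.mpr h1.symm
  let ψ' : P →ₗ[S] (G → S) := ((LinearMap.ker q.lin).liftQ ψ hψ).comp
    (q.lin.quotKerEquivOfSurjective hq).symm.toLinearMap
  have hψ' : ∀ v, ψ' (q.lin v) = ψ v := fun v => by
    have e : (q.lin.quotKerEquivOfSurjective hq).symm (q.lin v) = Submodule.Quotient.mk v := by
      rw [LinearEquiv.symm_apply_eq]
      rfl
    exact congrArg ((LinearMap.ker q.lin).liftQ ψ hψ) e
  refine isRegularLocalRing_of_sum_mul_eq h0 (fun i : G => i.1) (fun i => (hG i.2).1)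
    (fun i => (LinearMap.proj i).comp ψ') hb fun x => ?_
  obtain ⟨v, rfl⟩ := hq x
  have h1 : q.lin (ψ v) = b • q.lin v := by
    have h2 : q.lin ((kerι q).lin (φ v)) = 0 := (φ v).2
    change q.lin (b • v - (kerι q).lin (φ v)) = _
    rw [map_sub, h2, sub_zero, map_smul]
  exact ((hqv (ψ' (q.lin v))).symm.trans (congrArg (fun z => P.subtype (q.lin z)) (hψ' v))).trans
    (congrArg P.subtype h1)

end Noetherian

end GrMod

/-- If a non-maximal `P` contains a nonzero homogeneous element, its homogeneous core is a nonzero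
prime below it, hence `P` itself. The remaining primes need no Ext vanishing. -/
theorem isIsolatedSingularity_of_isHereditary {k : Type v} {S : Type u} [Field k] [CommRing S]
    [IsDomain S] [Algebra k S] [IsNoetherianRing S] (𝒜 : ℤ → Submodule k S) [GradedAlgebra 𝒜]
    (hdim : ringKrullDim S = 2) (h : IsHereditary (QGr 𝒜)) : IsIsolatedSingularity S := by
  let := HasExt.standard (QGr 𝒜)
  refine ⟨inferInstance, fun P _ hmax => ?_⟩
  by_cases hP : ∀ i, ∀ x ∈ 𝒜 i, x ∈ P → x = 0
  · obtain ⟨y, hy, hyP⟩ := GrMod.exists_forall_mul_mem_of_inhomogeneous hP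
    exact GrMod.isRegularLocalRing_of_forall_mul_mem y hy hyP
  push Not at hP
  obtain ⟨i, x, hxi, hxP, hx0⟩ := hP
  have hx : x ∈ (P.homogeneousCore 𝒜).toIdeal :=
    Ideal.mem_homogeneousCore_of_homogeneous_of_mem ⟨i, hxi⟩ hxP
  have hcore : (P.homogeneousCore 𝒜).toIdeal.IsPrime := Ideal.IsPrime.homogeneousCore inferInstance
  have hle : (P.homogeneousCore 𝒜).toIdeal ≤ P := Ideal.toIdeal_homogeneousCore_le 𝒜 P
  have heq : (P.homogeneousCore 𝒜).toIdeal = P := hle.eq_of_not_lt fun hlt =>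
    hmax (GrMod.isMaximal_of_ringKrullDim_eq_two hdim
      ((Submodule.ne_bot_iff _).mpr ⟨x, hx, hx0⟩) hlt)
  refine GrMod.isRegularLocalRing_of_isHomogeneous hmax (fun X Y α => ?_)
    ((Ideal.IsHomogeneous.iff_eq _ _).mpr heq) ((Submodule.ne_bot_iff _).mpr ⟨x, hxP, hx0⟩)
  exact (h _ _ 2 le_rfl).elim _ _

theorem mainTheorem11 {k : Type v} {S : Type u} [Field k] [CommRing S] [IsDomain S] [Algebra k S]
    [Algebra.FiniteType k S] [IsNoetherianRing S] (𝒜 : ℤ → Submodule k S) [GradedAlgebra 𝒜]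
    (hbdd : ∃ n : ℤ, ∀ i < n, 𝒜 i = ⊥) (hdim : ringKrullDim S = 2) :
    IsHereditary (QGr 𝒜) ↔ IsIsolatedSingularity S :=
  ⟨isIsolatedSingularity_of_isHereditary 𝒜 hdim, isHereditary_of_isIsolatedSingularity 𝒜 hdim⟩
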